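/- All graphs are finite and simple, and "$F$-free" means containing no (not necessarily induced) subgraph isomorphic to $F$. An edge of a graph is color-critical if deleting it decreases the chromatic number. For graphs $H$, $G$ on $h\le n$ vertices let $N(H,G)$ be the number of (not necessarily induced) subgraphs of $G$ isomorphic to $H$, and let $d(H,G)=N(H,G)/\binom{n}{h}$. **Lemma 2.6 (with Claim 1 of its proof).** Let $F$ be a graph with chromatic number $\chi(F)=r+1\ge 4$ and with a color-critical edge. Then the limit $$OPT_r(C_4)=\lim_{n\to\infty}\ \max\{\,d(C_4,G): G \text{ is an } F\text{-free graph on } n \text{ vertices}\,\}$$ exists, and $$OPT_r(C_4)=\frac{3(r-1)(r^2-3r+3)}{r^3}.$$ Moreover, for every $\delta>0$ there exist $\varepsilon>0$ and $n_0$ such that every $F$-free graph $G$ on $n\ge n_0$ vertices with $d(C_4,G)\ge OPT_r(C_4)-\varepsilon$ contains at most $\delta n^3$ induced copies of the co-cherry $P_3^c$, the graph on three vertices with exactly one edge (that is, at most $\delta n^3$ three-element vertex sets of $G$ induce exactly one edge). -/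

import Mathlib

namespace TuranGood

open SimpleGraph Filter

/-- `F` has a color-critical edge: an edge whose deletion decreases the chromatic number. -/
def HasColorCriticalEdge {W : Type*} (F : SimpleGraph W) : Prop :=
  ∃ e ∈ F.edgeSet, (F.deleteEdges {e}).chromaticNumber < F.chromaticNumber

/-- The density `d(H, G) = N(H, G) / (n(G) choose n(H))`, where `N(H, G)` is the number of (not
necessarily induced) subgraphs of `G` isomorphic to `H`. -/
noncomputable def density {U V : Type*} [Fintype U] [Fintype V]
    (H : SimpleGraph U) (G : SimpleGraph V) : ℝ :=
  (G.copyCount H : ℝ) / ((Fintype.card V).choose (Fintype.card U) : ℝ)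

/-- `N_I(H, G)`: the number of induced subgraphs of `G` isomorphic to `H`, i.e. the number of
vertex sets of `G` that induce a graph isomorphic to `H`. -/
noncomputable def inducedCopyCount {U V : Type*}
    (H : SimpleGraph U) (G : SimpleGraph V) : ℕ :=
  Set.ncard {S : Set V | Nonempty (H ≃g G.induce S)}

/-- The four-cycle. -/
abbrev C4 : SimpleGraph (Fin 4) := cycleGraph 4

/-- The co-cherry: the complement of the path on three vertices, with exactly one edge. -/
abbrev coCherry : SimpleGraph (Fin 3) := (pathGraph 3)ᶜ

/-- The maximum of `d(C₄, G)` over all `F`-free graphs `G` on `n` vertices. -/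
noncomputable def maxDensityC4 {W : Type*} (F : SimpleGraph W) (n : ℕ) : ℝ :=
  ⨆ G : {G : SimpleGraph (Fin n) // F.Free G}, density C4 G.1

/-- `OPT(C₄)` for the forbidden graph `F`: the limit of the maximum density of `C₄`. -/
noncomputable def OPT {W : Type*} (F : SimpleGraph W) : ℝ :=
  limUnder atTop (maxDensityC4 F)

end TuranGood

/-! Everything rests on one inequality, `mixedWeight_le_turanC4`: for a vertex-weighted
`K_{r+1}`-free graph, the `C₄` homomorphism density plus `1/27` of the induced co-cherry density is
at most the `C₄` density of the balanced complete `r`-partite graph. The co-cherry term is a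
penalty. It vanishes on complete multipartite graphs, so adding it does not raise the extremal
value, and a graph whose `C₄` density is nearly extremal can therefore contain few co-cherries.

The inequality is proved by Zykov symmetrisation in the style of Motzkin and Straus. Along the
direction that shifts weight between two nonadjacent vertices, the functional is a polynomial of
degree at most two. Its `C₄` part is convex and its co-cherry part concave. At a maximiser every
degree is at least `1/8`, which makes the convex part dominate (`exists_card_suppF_lt_of_isMaxOn`).
A maximiser can thus be chosen with clique support. There the co-cherry term is zero, equal weights
are forced, and the value `turanC4 k`, for a clique of size `k ≤ r`, increases with `k`.

To pass to `F`-free graphs, a large such graph has few copies of `K_{r+1}`, since it contains no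
large blow-up of `K_{r+1}` (`exists_cliqueDensity_le_of_free`). A random sample of `m` vertices is
then almost always `K_{r+1}`-free, and averaging the inequality over samples transfers it with a
small error (`exists_cliqueDensity_bound`). Turán graphs, which are `F`-free because `F` is not
`r`-colourable, give the matching lower bound. The factor between homomorphism density and `density`
is `4!/|Aut C₄| = 3`. -/

namespace TuranGood

open SimpleGraph Filter

set_option linter.unusedSectionVars false

/-! ### Weighted `C₄` and co-cherry counts, and how they change when weight moves between
nonadjacent vertices. -/

section Weighted

open Classical in
/-- The real-valued adjacency indicator of a graph. -/
noncomputable def adjInd {V : Type*} (G : SimpleGraph V) (a b : V) : ℝ :=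
  if G.Adj a b then 1 else 0

variable {V : Type*} {G : SimpleGraph V}

lemma adjInd_comm (a b : V) : adjInd G a b = adjInd G b a := by
  by_cases h : G.Adj a b <;> simp [adjInd, h, G.adj_comm b a]

@[simp] lemma adjInd_self (a : V) : adjInd G a a = 0 := by simp [adjInd]

lemma adjInd_nonneg (a b : V) : 0 ≤ adjInd G a b := by
  unfold adjInd; split_ifs <;> norm_num

lemma adjInd_le_one (a b : V) : adjInd G a b ≤ 1 := by
  unfold adjInd; split_ifs <;> norm_num

lemma adjInd_mul_self (a b : V) : adjInd G a b * adjInd G a b = adjInd G a b := by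
  unfold adjInd; split_ifs <;> norm_num

lemma adjInd_of_adj {a b : V} (h : G.Adj a b) : adjInd G a b = 1 := by simp [adjInd, h]

lemma adjInd_of_not_adj {a b : V} (h : ¬ G.Adj a b) : adjInd G a b = 0 := by simp [adjInd, h]

/-- The indicator of `a b` being the only edge among `a`, `b`, `c`. -/
noncomputable def coCherryInd (G : SimpleGraph V) (a b c : V) : ℝ :=
  adjInd G a b * (1 - adjInd G a c) * (1 - adjInd G b c)

lemma coCherryInd_nonneg (a b c : V) : 0 ≤ coCherryInd G a b c :=
  mul_nonneg (mul_nonneg (adjInd_nonneg _ _) (sub_nonneg.2 (adjInd_le_one _ _)))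
    (sub_nonneg.2 (adjInd_le_one _ _))

lemma coCherryInd_le_one (a b c : V) : coCherryInd G a b c ≤ 1 := by
  unfold coCherryInd adjInd; split_ifs <;> norm_num

variable [Fintype V]

/-- The weight of the common neighbourhood of `a` and `c`. -/
noncomputable def codeg (G : SimpleGraph V) (x : V → ℝ) (a c : V) : ℝ :=
  ∑ b, x b * (adjInd G a b * adjInd G b c)

/-- The weighted number of closed walks of length four. -/
noncomputable def c4Weight (G : SimpleGraph V) (x : V → ℝ) : ℝ :=
  ∑ a, ∑ c, x a * x c * codeg G x a c ^ 2

/-- The weighted number of labelled induced co-cherries. -/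
noncomputable def coCherryWeight (G : SimpleGraph V) (x : V → ℝ) : ℝ :=
  ∑ a, ∑ b, ∑ c, x a * x b * x c * coCherryInd G a b c

/-- The functional to be maximised. -/
noncomputable def mixedWeight (G : SimpleGraph V) (x : V → ℝ) : ℝ :=
  c4Weight G x + coCherryWeight G x / 27

lemma codeg_comm (x : V → ℝ) (a c : V) : codeg G x a c = codeg G x c a := by
  unfold codeg
  refine Finset.sum_congr rfl fun b _ => ?_
  rw [adjInd_comm a b, adjInd_comm b c]; ring

lemma codeg_self (x : V → ℝ) (a : V) : codeg G x a a = ∑ b, x b * adjInd G a b := by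
  unfold codeg
  refine Finset.sum_congr rfl fun b _ => ?_
  rw [adjInd_comm b a, adjInd_mul_self]

lemma codeg_nonneg {x : V → ℝ} (hx : ∀ a, 0 ≤ x a) (a c : V) : 0 ≤ codeg G x a c :=
  Finset.sum_nonneg fun b _ => mul_nonneg (hx b) (mul_nonneg (adjInd_nonneg _ _) (adjInd_nonneg _ _))

lemma codeg_le_self {x : V → ℝ} (hx : ∀ a, 0 ≤ x a) (a c : V) :
    codeg G x a c ≤ codeg G x a a := by
  rw [codeg_self]
  refine Finset.sum_le_sum fun b _ => mul_le_mul_of_nonneg_left ?_ (hx b)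
  exact mul_le_of_le_one_right (adjInd_nonneg _ _) (adjInd_le_one _ _)

lemma codeg_le_one {x : V → ℝ} (hx : x ∈ stdSimplex ℝ V) (a c : V) : codeg G x a c ≤ 1 := by
  refine (codeg_le_self hx.1 a c).trans ?_
  rw [codeg_self, ← hx.2]
  exact Finset.sum_le_sum fun b _ => mul_le_of_le_one_right (hx.1 b) (adjInd_le_one _ _)

variable [DecidableEq V]

lemma sum_single_sub_single_mul (u v : V) (f : V → ℝ) :
    ∑ a, ((Pi.single u 1 - Pi.single v 1 : V → ℝ) a) * f a = f u - f v := by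
  simp [sub_mul, Finset.sum_sub_distrib, Pi.single_apply]

lemma codeg_add_smul (x z : V → ℝ) (t : ℝ) (a c : V) :
    codeg G (x + t • z) a c = codeg G x a c + t * codeg G z a c := by
  simp [codeg, add_mul, Finset.sum_add_distrib, Finset.mul_sum, mul_assoc]

lemma single_sub_single_mul_adjInd {u v : V} (h : ¬ G.Adj u v) (a b : V) :
    ((Pi.single u 1 - Pi.single v 1 : V → ℝ) a) *
      ((Pi.single u 1 - Pi.single v 1 : V → ℝ) b) * adjInd G a b = 0 := by
  have h' : ¬ G.Adj v u := fun e => h e.symm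
  by_cases hau : a = u <;> by_cases hav : a = v <;> by_cases hbu : b = u <;>
    by_cases hbv : b = v <;> subst_vars <;>
    simp_all [adjInd_of_not_adj]

/-- A nonzero summand would need an edge inside `{u, v}`. This kills every term in which two
consecutive vertices of a closed 4-walk both carry the perturbation. -/
lemma single_sub_single_mul_codeg {u v : V} (h : ¬ G.Adj u v) (a c : V) :
    ((Pi.single u 1 - Pi.single v 1 : V → ℝ) a) *
      codeg G (Pi.single u 1 - Pi.single v 1 : V → ℝ) a c = 0 := by
  rw [codeg, Finset.mul_sum]
  refine Finset.sum_eq_zero fun b _ => ?_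
  have := single_sub_single_mul_adjInd h a b
  linear_combination (adjInd G b c) * this

lemma codeg_single_sub_single {u v : V} (a c : V) :
    codeg G (Pi.single u 1 - Pi.single v 1 : V → ℝ) a c =
      adjInd G a u * adjInd G u c - adjInd G a v * adjInd G v c := by
  rw [codeg, sum_single_sub_single_mul u v fun b => adjInd G a b * adjInd G b c]

lemma sum_mul_codeg_sq (x : V → ℝ) (u v : V) :
    ∑ a, ∑ c, x a * x c * (adjInd G a u * adjInd G u c - adjInd G a v * adjInd G v c) ^ 2 =
      codeg G x u u ^ 2 + codeg G x v v ^ 2 - 2 * codeg G x u v ^ 2 := by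
  have key : ∀ a c, x a * x c *
      (adjInd G a u * adjInd G u c - adjInd G a v * adjInd G v c) ^ 2 =
      (x a * adjInd G u a) * (x c * adjInd G u c) + (x a * adjInd G v a) * (x c * adjInd G v c)
      - 2 * ((x a * (adjInd G u a * adjInd G a v)) * (x c * (adjInd G u c * adjInd G c v))) := by
    intro a c
    rw [adjInd_comm a u, adjInd_comm a v, adjInd_comm c v]
    linear_combination (x a * x c * adjInd G u c ^ 2) * adjInd_mul_self (G := G) u a +
      (x a * x c * adjInd G u a) * adjInd_mul_self (G := G) u c +
      (x a * x c * adjInd G v c ^ 2) * adjInd_mul_self (G := G) v a +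
      (x a * x c * adjInd G v a) * adjInd_mul_self (G := G) v c
  simp_rw [key, Finset.sum_sub_distrib, Finset.sum_add_distrib, ← Finset.mul_sum,
    ← Finset.sum_mul]
  rw [codeg_self, codeg_self]
  unfold codeg
  ring

/-- Only opposite vertices of the 4-walk can both be perturbed, so nothing of degree three or four
in `t` survives. The two opposite pairs contribute equally, whence the factor 2. The coefficient is
nonnegative because codegrees are at most degrees. -/
lemma c4Weight_move {u v : V} (h : ¬ G.Adj u v) (x : V → ℝ) :
    ∃ α : ℝ, ∀ t : ℝ, c4Weight G (x + t • (Pi.single u 1 - Pi.single v 1)) =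
      c4Weight G x + α * t +
        2 * (codeg G x u u ^ 2 + codeg G x v v ^ 2 - 2 * codeg G x u v ^ 2) * t ^ 2 := by
  set z : V → ℝ := Pi.single u 1 - Pi.single v 1 with hz
  refine ⟨∑ a, ∑ c, (2 * x a * x c * codeg G x a c * codeg G z a c +
    (z a * x c + x a * z c) * codeg G x a c ^ 2), fun t => ?_⟩
  have e1 : ∑ a, ∑ c, x a * x c * codeg G z a c ^ 2 =
      codeg G x u u ^ 2 + codeg G x v v ^ 2 - 2 * codeg G x u v ^ 2 := by
    simp_rw [hz, codeg_single_sub_single]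
    exact sum_mul_codeg_sq x u v
  have e2 : ∑ a, ∑ c, z a * z c * codeg G x a c ^ 2 =
      codeg G x u u ^ 2 + codeg G x v v ^ 2 - 2 * codeg G x u v ^ 2 := by
    simp_rw [mul_assoc, ← Finset.mul_sum, hz, sum_single_sub_single_mul]
    rw [codeg_comm x v u]; ring
  have e3 : 2 * (codeg G x u u ^ 2 + codeg G x v v ^ 2 - 2 * codeg G x u v ^ 2) =
      ∑ a, ∑ c, (x a * x c * codeg G z a c ^ 2 + z a * z c * codeg G x a c ^ 2) := by
    simp_rw [Finset.sum_add_distrib]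
    rw [e1, e2]; ring
  rw [e3]
  unfold c4Weight
  simp_rw [Finset.sum_mul, ← Finset.sum_add_distrib]
  refine Finset.sum_congr rfl fun a _ => Finset.sum_congr rfl fun c _ => ?_
  rw [codeg_add_smul]
  have h1 : z a * codeg G z a c = 0 := single_sub_single_mul_codeg h a c
  have h2 : z c * codeg G z a c = 0 := by
    rw [codeg_comm]; exact single_sub_single_mul_codeg h c a
  simp only [Pi.add_apply, Pi.smul_apply, smul_eq_mul]
  linear_combination (t * (x c + t * z c) * (2 * t * codeg G x a c + t ^ 2 * codeg G z a c)) * h1 +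
    (t * x a * (2 * t * codeg G x a c + t ^ 2 * codeg G z a c)) * h2

/-- The two ends of the edge cannot both be perturbed, so the quadratic term comes from perturbing
the isolated vertex together with one end. It is minus the weight of vertices adjacent to exactly
one of `u`, `v`, once for each end. -/
lemma coCherryWeight_move {u v : V} (h : ¬ G.Adj u v) (x : V → ℝ) :
    ∃ α : ℝ, ∀ t : ℝ, coCherryWeight G (x + t • (Pi.single u 1 - Pi.single v 1)) =
      coCherryWeight G x + α * t -
        2 * (codeg G x u u + codeg G x v v - 2 * codeg G x u v) * t ^ 2 := by
  set z : V → ℝ := Pi.single u 1 - Pi.single v 1 with hz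
  refine ⟨∑ a, ∑ b, ∑ c, (z a * x b * x c + x a * z b * x c + x a * x b * z c) *
    coCherryInd G a b c, fun t => ?_⟩
  have pt : ∀ b, coCherryInd G u b u - coCherryInd G u b v -
      (coCherryInd G v b u - coCherryInd G v b v) =
      - (adjInd G u b + adjInd G v b - 2 * (adjInd G u b * adjInd G b v)) := by
    intro b
    unfold coCherryInd
    rw [adjInd_of_not_adj h, adjInd_of_not_adj (fun e => h e.symm), adjInd_comm b u,
      adjInd_comm b v, adjInd_self, adjInd_self]
    linear_combination -adjInd_mul_self (G := G) u b - adjInd_mul_self (G := G) v b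
  have s : ∑ b, x b * -(adjInd G u b + adjInd G v b - 2 * (adjInd G u b * adjInd G b v)) =
      -(codeg G x u u + codeg G x v v - 2 * codeg G x u v) := by
    rw [codeg_self, codeg_self, codeg, Finset.mul_sum, ← Finset.sum_add_distrib,
      ← Finset.sum_sub_distrib, ← Finset.sum_neg_distrib]
    exact Finset.sum_congr rfl fun b _ => by ring
  have e1 : ∑ a, ∑ b, ∑ c, z a * x b * z c * coCherryInd G a b c =
      -(codeg G x u u + codeg G x v v - 2 * codeg G x u v) := by
    rw [Finset.sum_comm, ← s]
    refine Finset.sum_congr rfl fun b _ => ?_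
    have : ∀ a, ∑ c, z a * x b * z c * coCherryInd G a b c =
        z a * (x b * (coCherryInd G a b u - coCherryInd G a b v)) := fun a => by
      rw [← sum_single_sub_single_mul u v fun c => coCherryInd G a b c, Finset.mul_sum,
        Finset.mul_sum]
      exact Finset.sum_congr rfl fun c _ => by rw [← hz]; ring
    simp_rw [this]
    rw [sum_single_sub_single_mul u v fun a => x b * (coCherryInd G a b u - coCherryInd G a b v),
      ← mul_sub, pt]
  have e2 : ∑ a, ∑ b, ∑ c, x a * z b * z c * coCherryInd G a b c =
      -(codeg G x u u + codeg G x v v - 2 * codeg G x u v) := by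
    rw [← e1, Finset.sum_comm]
    refine Finset.sum_congr rfl fun a _ => Finset.sum_congr rfl fun b _ =>
      Finset.sum_congr rfl fun c _ => ?_
    unfold coCherryInd
    rw [adjInd_comm b a]; ring
  have e3 : -2 * (codeg G x u u + codeg G x v v - 2 * codeg G x u v) =
      ∑ a, ∑ b, ∑ c, (z a * x b * z c + x a * z b * z c) * coCherryInd G a b c := by
    simp_rw [add_mul, Finset.sum_add_distrib]
    rw [e1, e2]; ring
  have e4 : coCherryWeight G x + (∑ a, ∑ b, ∑ c, (z a * x b * x c + x a * z b * x c +
      x a * x b * z c) * coCherryInd G a b c) * t -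
      2 * (codeg G x u u + codeg G x v v - 2 * codeg G x u v) * t ^ 2 =
      coCherryWeight G x + (∑ a, ∑ b, ∑ c, (z a * x b * x c + x a * z b * x c +
      x a * x b * z c) * coCherryInd G a b c) * t +
      (-2 * (codeg G x u u + codeg G x v v - 2 * codeg G x u v)) * t ^ 2 := by ring
  rw [e4, e3]
  unfold coCherryWeight
  simp_rw [Finset.sum_mul, ← Finset.sum_add_distrib]
  refine Finset.sum_congr rfl fun a _ => Finset.sum_congr rfl fun b _ =>
    Finset.sum_congr rfl fun c _ => ?_
  have h1 : z a * z b * adjInd G a b = 0 := single_sub_single_mul_adjInd h a b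
  simp only [Pi.add_apply, Pi.smul_apply, smul_eq_mul]
  unfold coCherryInd
  linear_combination (t ^ 2 * (x c + t * z c) * (1 - adjInd G a c) * (1 - adjInd G b c)) * h1

end Weighted

/-! ### Symmetrisation: maximisers with clique support. -/

section Maximizer

variable {V : Type*} {G : SimpleGraph V} [Fintype V] [DecidableEq V]

lemma coCherryWeight_nonneg {x : V → ℝ} (hx : ∀ a, 0 ≤ x a) : 0 ≤ coCherryWeight G x :=
  Finset.sum_nonneg fun a _ => Finset.sum_nonneg fun b _ => Finset.sum_nonneg fun c _ =>
    mul_nonneg (mul_nonneg (mul_nonneg (hx a) (hx b)) (hx c)) (coCherryInd_nonneg _ _ _)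

lemma coCherryWeight_le {x : V → ℝ} (hx : ∀ a, 0 ≤ x a) :
    coCherryWeight G x ≤ (∑ a, x a) ^ 3 := by
  have : (∑ a, x a) ^ 3 = ∑ a, ∑ b, ∑ c, x a * x b * x c := by
    simp_rw [← Finset.mul_sum, mul_assoc, ← Finset.mul_sum, ← Finset.sum_mul]
    ring
  rw [this]
  exact Finset.sum_le_sum fun a _ => Finset.sum_le_sum fun b _ => Finset.sum_le_sum fun c _ =>
    mul_le_of_le_one_right (mul_nonneg (mul_nonneg (hx a) (hx b)) (hx c)) (coCherryInd_le_one _ _ _)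

lemma sum_single_mul (u : V) (s : ℝ) (f : V → ℝ) :
    ∑ a, (Pi.single u s : V → ℝ) a * f a = s * f u := by
  simp [Pi.single_apply]

lemma codeg_sub_single (x : V → ℝ) (u : V) (s : ℝ) (a c : V) :
    codeg G (x - Pi.single u s) a c = codeg G x a c - s * (adjInd G a u * adjInd G u c) := by
  rw [← sum_single_mul u s fun b => adjInd G a b * adjInd G b c, codeg, codeg,
    ← Finset.sum_sub_distrib]
  exact Finset.sum_congr rfl fun b _ => by simp only [Pi.sub_apply]; ring

/-- Deletion destroys only closed 4-walks through `u`. For each of the four positions of `u`, both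
neighbours on the walk lie in its neighbourhood, so these walks weigh at most `x u` times the
squared degree. -/
lemma c4Weight_sub_le {x : V → ℝ} (hx : x ∈ stdSimplex ℝ V) (u : V) :
    c4Weight G x - c4Weight G (x - Pi.single u (x u)) ≤ x u * (4 * codeg G x u u ^ 2) := by
  set s := x u with hs
  have hs0 : 0 ≤ s := hx.1 u
  set e : V → ℝ := Pi.single u s with he
  have e0 : ∀ a, 0 ≤ e a := fun a => by
    by_cases h : a = u <;> simp [he, h, hs0]
  have ex : ∀ a, e a ≤ x a := fun a => by
    by_cases h : a = u <;> simp [he, h, hs, hx.1 a]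
  have key : c4Weight G x - c4Weight G (x - e) ≤
      ∑ a, ∑ c, (e a * (x c * codeg G x a c ^ 2) + x a * (e c * codeg G x a c ^ 2) +
        2 * s * ((x a * adjInd G u a) * (x c * adjInd G u c))) := by
    unfold c4Weight
    simp_rw [← Finset.sum_sub_distrib]
    refine Finset.sum_le_sum fun a _ => Finset.sum_le_sum fun c _ => ?_
    rw [he, codeg_sub_single, ← he, adjInd_comm a u]
    simp only [Pi.sub_apply]
    set p := adjInd G u a * adjInd G u c with hp
    have hp0 : 0 ≤ p := mul_nonneg (adjInd_nonneg _ _) (adjInd_nonneg _ _)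
    set d := codeg G x a c
    have hd0 : 0 ≤ d := codeg_nonneg hx.1 a c
    have hd1 : d ≤ 1 := codeg_le_one hx a c
    have hxx : 0 ≤ x a * x c := mul_nonneg (hx.1 a) (hx.1 c)
    have hsub : (x a - e a) * (x c - e c) ≥ x a * x c - e a * x c - x a * e c := by
      nlinarith [mul_nonneg (e0 a) (e0 c)]
    have hsub' : (x a - e a) * (x c - e c) ≤ x a * x c :=
      mul_le_mul (by linarith [e0 a]) (by linarith [e0 c]) (by linarith [ex c]) (hx.1 a)
    have hsub0 : 0 ≤ (x a - e a) * (x c - e c) :=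
      mul_nonneg (by linarith [ex a]) (by linarith [ex c])
    -- Expand the square, discard `(s * p) ^ 2` and use `d ≤ 1`.
    have h1 : (x a - e a) * (x c - e c) * (d - s * p) ^ 2 ≥
        (x a - e a) * (x c - e c) * (d ^ 2 - 2 * s * p) := by
      refine mul_le_mul_of_nonneg_left ?_ hsub0
      nlinarith [mul_nonneg (mul_nonneg hs0 hp0) (sub_nonneg.2 hd1), sq_nonneg (s * p)]
    have h2 := mul_le_mul_of_nonneg_right hsub (sq_nonneg d)
    have h3 := mul_le_mul_of_nonneg_right hsub' (mul_nonneg hs0 hp0)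
    have h4 : x a * adjInd G u a * (x c * adjInd G u c) = x a * x c * p := by rw [hp]; ring
    rw [h4]
    nlinarith
  refine key.trans ?_
  have dsq : ∀ a c, codeg G x a c ^ 2 ≤ codeg G x a a ^ 2 := fun a c =>
    pow_le_pow_left₀ (codeg_nonneg hx.1 _ _) (codeg_le_self hx.1 a c) 2
  have f1 : ∑ a, ∑ c, e a * (x c * codeg G x a c ^ 2) ≤ s * codeg G x u u ^ 2 := by
    simp_rw [← Finset.mul_sum]
    rw [he, sum_single_mul u s fun a => ∑ c, x c * codeg G x a c ^ 2]
    refine mul_le_mul_of_nonneg_left ?_ hs0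
    calc ∑ c, x c * codeg G x u c ^ 2 ≤ ∑ c, x c * codeg G x u u ^ 2 :=
          Finset.sum_le_sum fun c _ => mul_le_mul_of_nonneg_left (dsq u c) (hx.1 c)
      _ = codeg G x u u ^ 2 := by rw [← Finset.sum_mul, hx.2, one_mul]
  have f2 : ∑ a, ∑ c, x a * (e c * codeg G x a c ^ 2) ≤ s * codeg G x u u ^ 2 := by
    refine le_trans (le_of_eq ?_) f1
    rw [Finset.sum_comm]
    exact Finset.sum_congr rfl fun a _ => Finset.sum_congr rfl fun c _ => by
      rw [codeg_comm]; ring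
  have f3 : ∑ a, ∑ c, 2 * s * ((x a * adjInd G u a) * (x c * adjInd G u c)) =
      2 * s * codeg G x u u ^ 2 := by
    simp_rw [← Finset.mul_sum, ← Finset.sum_mul]
    rw [codeg_self]; ring
  simp_rw [Finset.sum_add_distrib]
  rw [f3]
  linarith

lemma coCherryWeight_sub_le {x : V → ℝ} (hx : x ∈ stdSimplex ℝ V) (u : V) :
    coCherryWeight G x - coCherryWeight G (x - Pi.single u (x u)) ≤ 3 * x u := by
  set s := x u with hs
  have hs0 : 0 ≤ s := hx.1 u
  set e : V → ℝ := Pi.single u s with he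
  have e0 : ∀ a, 0 ≤ e a := fun a => by
    by_cases h : a = u <;> simp [he, h, hs0]
  have ex : ∀ a, e a ≤ x a := fun a => by
    by_cases h : a = u <;> simp [he, h, hs, hx.1 a]
  have es : ∑ a, e a = s := by simp [he]
  have key : coCherryWeight G x - coCherryWeight G (x - e) ≤
      ∑ a, ∑ b, ∑ c, (e a * x b * x c + x a * e b * x c + x a * x b * e c) := by
    unfold coCherryWeight
    simp_rw [← Finset.sum_sub_distrib]
    refine Finset.sum_le_sum fun a _ => Finset.sum_le_sum fun b _ => Finset.sum_le_sum fun c _ => ?_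
    simp only [Pi.sub_apply]
    rw [← sub_mul]
    have h1 : (x a - e a) * (x b - e b) ≥ x a * x b - e a * x b - x a * e b := by
      nlinarith [mul_nonneg (e0 a) (e0 b)]
    have h1' : (x a - e a) * (x b - e b) ≤ x a * x b :=
      mul_le_mul (by linarith [e0 a]) (by linarith [e0 b]) (by linarith [ex b]) (hx.1 a)
    have h2 := mul_le_mul_of_nonneg_right h1 (hx.1 c)
    have h3 := mul_le_mul_of_nonneg_right h1' (e0 c)
    have h4 : (x a - e a) * (x b - e b) * (x c - e c) ≤ x a * x b * x c :=
      mul_le_mul h1' (by linarith [e0 c]) (by linarith [ex c]) (mul_nonneg (hx.1 a) (hx.1 b))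
    refine (mul_le_of_le_one_right (by linarith) (coCherryInd_le_one _ _ _)).trans ?_
    nlinarith
  refine key.trans (le_of_eq ?_)
  simp_rw [Finset.sum_add_distrib, ← Finset.mul_sum, ← Finset.sum_mul, ← Finset.mul_sum,
    ← Finset.sum_mul, es, hx.2]
  ring

lemma codeg_smul (w : ℝ) (x : V → ℝ) (a c : V) : codeg G (w • x) a c = w * codeg G x a c := by
  simp [codeg, Finset.mul_sum, mul_assoc]

lemma c4Weight_smul (w : ℝ) (x : V → ℝ) : c4Weight G (w • x) = w ^ 4 * c4Weight G x := by
  simp only [c4Weight, codeg_smul, Finset.mul_sum, Pi.smul_apply, smul_eq_mul]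
  exact Finset.sum_congr rfl fun a _ => Finset.sum_congr rfl fun c _ => by ring

lemma coCherryWeight_smul (w : ℝ) (x : V → ℝ) :
    coCherryWeight G (w • x) = w ^ 3 * coCherryWeight G x := by
  simp only [coCherryWeight, Finset.mul_sum, Pi.smul_apply, smul_eq_mul]
  exact Finset.sum_congr rfl fun a _ => Finset.sum_congr rfl fun b _ =>
    Finset.sum_congr rfl fun c _ => by ring

/-- Deleting a vertex from a maximiser shows that no vertex in its support has small degree. -/
lemma le_degree_of_isMaxOn {x : V → ℝ} (hx : x ∈ stdSimplex ℝ V)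
    (hmax : IsMaxOn (mixedWeight G) (stdSimplex ℝ V) x) (hq : 2 / 9 ≤ mixedWeight G x)
    {u : V} (hu : 0 < x u) (hu1 : x u < 1) : 1 / 8 ≤ codeg G x u u := by
  set s := x u with hs
  set y : V → ℝ := x - Pi.single u s with hy
  have y0 : ∀ a, 0 ≤ y a := fun a => by
    by_cases h : a = u
    · subst h; simp [hy, hs]
    · simp [hy, h, hx.1 a]
  have ysum : ∑ a, y a = 1 - s := by
    simp [hy, Finset.sum_sub_distrib, hx.2]
  have hw : 0 < 1 - s := by linarith
  have hmem : (1 - s)⁻¹ • y ∈ stdSimplex ℝ V := by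
    refine ⟨fun a => mul_nonneg (inv_nonneg.2 hw.le) (y0 a), ?_⟩
    simp only [Pi.smul_apply, smul_eq_mul, ← Finset.mul_sum, ysum]
    exact inv_mul_cancel₀ hw.ne'
  have hle : mixedWeight G ((1 - s)⁻¹ • y) ≤ mixedWeight G x := hmax hmem
  have h4 := c4Weight_sub_le (G := G) hx u
  have h3 := coCherryWeight_sub_le (G := G) hx u
  have hc := coCherryWeight_le (G := G) y0
  have hc0 := coCherryWeight_nonneg (G := G) y0
  rw [ysum] at hc
  rw [← hs, ← hy] at h4 h3
  set q := mixedWeight G x with hqd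
  -- `y` has total mass `1 - s`. Maximality is applied to its normalisation, and the two parts are
  -- homogeneous of degrees 4 and 3.
  have hle' : c4Weight G y + (1 - s) * coCherryWeight G y / 27 ≤ (1 - s) ^ 4 * q := by
    have := mul_le_mul_of_nonneg_left hle (pow_pos hw 4).le
    refine le_trans (le_of_eq ?_) this
    rw [mixedWeight, c4Weight_smul, coCherryWeight_smul]
    field_simp
  have hcle : coCherryWeight G y ≤ 1 := hc.trans (pow_le_one₀ hw.le (by linarith))
  have hqe : q = c4Weight G x + coCherryWeight G x / 27 := rfl
  have hpow : (1 - s) ^ 4 ≤ 1 - s := pow_le_of_le_one hw.le (by linarith) (by norm_num)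
  have hpq : (1 - s) ^ 4 * q ≤ (1 - s) * q := mul_le_mul_of_nonneg_right hpow (by linarith)
  have hsc : s * coCherryWeight G y ≤ s := mul_le_of_le_one_right hu.le hcle
  -- With `q ≥ 2/9 = 6/27` this gives squared degree at least `1/54`, which exceeds `1/64`.
  have hfin : s * q ≤ s * (4 * codeg G x u u ^ 2 + 4 / 27) := by nlinarith
  have hfin' := le_of_mul_le_mul_left hfin hu
  by_contra hlt
  push Not at hlt
  have := codeg_nonneg (G := G) hx.1 u u
  nlinarith

/-- The support of a weight vector. -/
noncomputable def suppF (x : V → ℝ) : Finset V := Finset.univ.filter fun a => x a ≠ 0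

lemma mem_suppF {x : V → ℝ} {a : V} : a ∈ suppF x ↔ x a ≠ 0 := by simp [suppF]

/-- Moving the weight of a vertex in the support of a maximiser to a nonadjacent vertex. -/
lemma exists_card_suppF_lt_of_isMaxOn {x : V → ℝ} (hx : x ∈ stdSimplex ℝ V)
    (hmax : IsMaxOn (mixedWeight G) (stdSimplex ℝ V) x) (hq : 2 / 9 ≤ mixedWeight G x)
    {u v : V} (hu : x u ≠ 0) (hv : x v ≠ 0) (huv : u ≠ v) (hadj : ¬ G.Adj u v) :
    ∃ y ∈ stdSimplex ℝ V, mixedWeight G y = mixedWeight G x ∧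
      (suppF y).card < (suppF x).card := by
  have hu0 : 0 < x u := lt_of_le_of_ne (hx.1 u) hu.symm
  have hv0 : 0 < x v := lt_of_le_of_ne (hx.1 v) hv.symm
  have hsum : x u + x v ≤ 1 := by
    rw [← hx.2, ← Finset.sum_pair huv]
    exact Finset.sum_le_sum_of_subset_of_nonneg (Finset.subset_univ _) fun i _ _ => hx.1 i
  set z : V → ℝ := Pi.single u 1 - Pi.single v 1 with hz
  have zu : z u = 1 := by simp [hz, huv]
  have zv : z v = -1 := by simp [hz, huv.symm]
  have zo : ∀ a, a ≠ u → a ≠ v → z a = 0 := fun a h h' => by simp [hz, h, h']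
  have hmem : ∀ t : ℝ, -x u ≤ t → t ≤ x v → x + t • z ∈ stdSimplex ℝ V := by
    intro t h1 h2
    refine ⟨fun a => ?_, ?_⟩
    · by_cases hau : a = u
      · subst hau; simp [zu]; linarith
      · by_cases hav : a = v
        · subst hav; simp [zv]; linarith
        · simp [zo a hau hav, hx.1 a]
    · simp [Finset.sum_add_distrib, hx.2, ← Finset.mul_sum, hz, Finset.sum_sub_distrib]
  obtain ⟨α, hα⟩ := c4Weight_move hadj x
  obtain ⟨α', hα'⟩ := coCherryWeight_move hadj x
  have du := le_degree_of_isMaxOn hx hmax hq hu0 (by linarith)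
  have dv := le_degree_of_isMaxOn hx hmax hq hv0 (by linarith)
  have cu := codeg_le_self (G := G) hx.1 u v
  have cv := codeg_le_self (G := G) hx.1 v u
  rw [codeg_comm x v u] at cv
  have c0 := codeg_nonneg (G := G) hx.1 u v
  set A := codeg G x u u
  set B := codeg G x v v
  set C := codeg G x u v
  obtain ⟨γ, β, hβ, hQ⟩ : ∃ γ β : ℝ, 0 ≤ β ∧
      ∀ t : ℝ, mixedWeight G (x + t • z) = mixedWeight G x + γ * t + β * t ^ 2 := by
    -- The leading coefficient equals `2(A-C)(A+C-1/27) + 2(B-C)(B+C-1/27)`. It is nonnegative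
    -- because `A, B ≥ 1/8 > 1/27`.
    refine ⟨α + α' / 27, 2 * (A ^ 2 + B ^ 2 - 2 * C ^ 2) - 2 / 27 * (A + B - 2 * C), ?_, fun t => ?_⟩
    · nlinarith [mul_nonneg (sub_nonneg.2 cu) (show 0 ≤ 2 * (A + C) - 2 / 27 by linarith),
        mul_nonneg (sub_nonneg.2 cv) (show 0 ≤ 2 * (B + C) - 2 / 27 by linarith)]
    · rw [mixedWeight, mixedWeight, hz, hα, hα']
      ring
  -- The endpoints `t = x v` and `t = -x u` empty `v` and `u` respectively. A convex quadratic with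
  -- an interior maximum is constant, so emptying `v` costs nothing.
  have i1 : mixedWeight G (x + x v • z) ≤ mixedWeight G x :=
    hmax (hmem _ (by linarith) le_rfl)
  have i2 : mixedWeight G (x + (-x u) • z) ≤ mixedWeight G x :=
    hmax (hmem _ le_rfl (by linarith))
  rw [hQ] at i1 i2
  have j1 : γ + β * x v ≤ 0 := by
    by_contra h
    push Not at h
    nlinarith [mul_pos h hv0]
  have j2 : -γ + β * x u ≤ 0 := by
    by_contra h
    push Not at h
    nlinarith [mul_pos h hu0]
  have hβ0 : β = 0 := by
    by_contra h
    have : 0 < β := lt_of_le_of_ne hβ (Ne.symm h)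
    nlinarith [mul_pos this hu0, mul_pos this hv0]
  have hγ : γ = 0 := by subst hβ0; linarith
  refine ⟨x + x v • z, hmem _ (by linarith) le_rfl, ?_, ?_⟩
  · rw [hQ, hβ0, hγ]; ring
  · refine Finset.card_lt_card (Finset.ssubset_iff_of_subset ?_ |>.2 ⟨v, mem_suppF.2 hv, ?_⟩)
    · intro a ha
      rw [mem_suppF] at ha ⊢
      by_cases hau : a = u
      · subst hau; exact hu
      · by_cases hav : a = v
        · subst hav; exact hv
        · simpa [zo a hau hav] using ha
    · rw [mem_suppF]
      simp [zv]

lemma continuous_mixedWeight : Continuous (mixedWeight G) := by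
  unfold mixedWeight c4Weight coCherryWeight codeg
  fun_prop

/-- Compactness gives a maximiser. While its support contains a nonadjacent pair, the support can be
shrunk without changing the value. -/
lemma exists_isMaxOn_clique [Nonempty V] (hq : ∃ x ∈ stdSimplex ℝ V, 2 / 9 ≤ mixedWeight G x) :
    ∃ x ∈ stdSimplex ℝ V, IsMaxOn (mixedWeight G) (stdSimplex ℝ V) x ∧
      ∀ a b, x a ≠ 0 → x b ≠ 0 → a ≠ b → G.Adj a b := by
  obtain ⟨x₀, hx₀, hmax₀⟩ := (isCompact_stdSimplex ℝ V).exists_isMaxOn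
    (let ⟨x, hx, _⟩ := hq; ⟨x, hx⟩) (continuous_mixedWeight (G := G)).continuousOn
  have hq₀ : 2 / 9 ≤ mixedWeight G x₀ := by
    obtain ⟨x, hx, h⟩ := hq
    exact h.trans (hmax₀ hx)
  have main : ∀ n : ℕ, ∀ x ∈ stdSimplex ℝ V, IsMaxOn (mixedWeight G) (stdSimplex ℝ V) x →
      2 / 9 ≤ mixedWeight G x → (suppF x).card = n →
      ∃ x ∈ stdSimplex ℝ V, IsMaxOn (mixedWeight G) (stdSimplex ℝ V) x ∧
        ∀ a b, x a ≠ 0 → x b ≠ 0 → a ≠ b → G.Adj a b := by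
    intro n
    induction n using Nat.strong_induction_on with
    | _ n ih =>
      intro x hx hmax hq hn
      by_cases hcl : ∀ a b, x a ≠ 0 → x b ≠ 0 → a ≠ b → G.Adj a b
      · exact ⟨x, hx, hmax, hcl⟩
      · push Not at hcl
        obtain ⟨a, b, ha, hb, hab, hadj⟩ := hcl
        obtain ⟨y, hy, hyq, hlt⟩ := exists_card_suppF_lt_of_isMaxOn hx hmax hq ha hb hab hadj
        refine ih _ (hn ▸ hlt) y hy (fun w hw => ?_) (hyq ▸ hq) rfl
        exact (hmax hw).trans_eq hyq.symm
  exact main _ x₀ hx₀ hmax₀ hq₀ rfl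

end Maximizer

/-! ### Optimising weights on a clique, and the bound for `K_{r+1}`-free graphs. -/

section CliqueWeights

variable {V : Type*} {G : SimpleGraph V} [Fintype V] [DecidableEq V]

/-- The `C₄` density of a balanced complete `r`-partite graph. -/
noncomputable def turanC4 (r : ℝ) : ℝ := (r - 1) * (r ^ 2 - 3 * r + 3) / r ^ 3

lemma turanC4_eq {r : ℝ} (hr : r ≠ 0) :
    turanC4 r = 1 - 4 * r⁻¹ + 6 * r⁻¹ ^ 2 - 3 * r⁻¹ ^ 3 := by
  unfold turanC4
  field_simp
  ring

/-- As a polynomial in `a = 1/k`, the function has derivative `-(3a - 2)²`. The identity below is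
the corresponding difference quotient, written as a sum of squares. -/
lemma turanC4_mono {k r : ℝ} (hk : 0 < k) (hkr : k ≤ r) : turanC4 k ≤ turanC4 r := by
  have hr : 0 < r := hk.trans_le hkr
  rw [turanC4_eq hk.ne', turanC4_eq hr.ne']
  have h := inv_anti₀ hk hkr
  set a := k⁻¹
  set b := r⁻¹
  have key : (1 - 4 * b + 6 * b ^ 2 - 3 * b ^ 3) - (1 - 4 * a + 6 * a ^ 2 - 3 * a ^ 3) =
      (a - b) * ((3 / 4) * (a + b - 4 / 3 ) ^ 2 * 3 + (3 * a ^ 2 + 3 * a * b + 3 * b ^ 2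
        - (9 / 4) * (a + b) ^ 2)) := by ring
  nlinarith [mul_nonneg (sub_nonneg.2 h) (sq_nonneg (a + b - 4 / 3)),
    mul_nonneg (sub_nonneg.2 h) (sq_nonneg (a - b))]

lemma two_ninths_le_turanC4 {r : ℝ} (hr : 3 ≤ r) : 2 / 9 ≤ turanC4 r := by
  refine le_trans (le_of_eq ?_) (turanC4_mono (by norm_num) hr)
  norm_num [turanC4]

/-- The weight vector `x` is supported on a clique. -/
def CliqueSupported (G : SimpleGraph V) (x : V → ℝ) : Prop :=
  ∀ a b, x a ≠ 0 → x b ≠ 0 → a ≠ b → G.Adj a b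

lemma CliqueSupported.mul_adjInd {x : V → ℝ} (h : CliqueSupported G x) {a : V} (ha : x a ≠ 0)
    (b : V) : x b * adjInd G a b = x b * (1 - if a = b then 1 else 0) := by
  by_cases hab : a = b
  · subst hab; simp
  · by_cases hb : x b = 0
    · simp [hb]
    · simp [adjInd_of_adj (h a b ha hb hab), hab]

lemma CliqueSupported.codeg_eq {x : V → ℝ} (h : CliqueSupported G x) (hs : ∑ a, x a = 1)
    {a c : V} (ha : x a ≠ 0) (hc : x c ≠ 0) :
    codeg G x a c = 1 - x a - x c + if a = c then x a else 0 := by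
  have : ∀ b, x b * (adjInd G a b * adjInd G b c) =
      x b - (if a = b then x b else 0) - (if c = b then x b else 0) +
        (if a = b then (if c = b then x b else 0) else 0) := by
    intro b
    have h1 := h.mul_adjInd ha b
    have h2 := h.mul_adjInd hc b
    rw [adjInd_comm b c]
    calc x b * (adjInd G a b * adjInd G c b) = (x b * adjInd G a b) * adjInd G c b := by ring
      _ = (x b * adjInd G c b) * (1 - if a = b then 1 else 0) := by rw [h1]; ring
      _ = _ := by rw [h2]; split_ifs <;> ring
  unfold codeg
  simp_rw [this]
  by_cases hac : a = c
  · subst hac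
    simp [Finset.sum_add_distrib, Finset.sum_sub_distrib, hs]
  · simp [Finset.sum_add_distrib, Finset.sum_sub_distrib, hs, hac, Ne.symm hac]

lemma CliqueSupported.c4Weight_eq {x : V → ℝ} (h : CliqueSupported G x) (hs : ∑ a, x a = 1) :
    c4Weight G x = 1 - 4 * ∑ a, x a ^ 2 + 2 * (∑ a, x a ^ 2) ^ 2 + 4 * ∑ a, x a ^ 3
      - 3 * ∑ a, x a ^ 4 := by
  have key : ∀ a c, x a * x c * codeg G x a c ^ 2 =
      x a * x c + x a ^ 3 * x c + x a * x c ^ 3 - 2 * (x a ^ 2 * x c) - 2 * (x a * x c ^ 2)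
        + 2 * (x a ^ 2 * x c ^ 2) + (if a = c then 2 * x a ^ 3 - 3 * x a ^ 4 else 0) := by
    intro a c
    by_cases ha : x a = 0
    · simp [ha]
    by_cases hc : x c = 0
    · by_cases hac : a = c
      · subst hac; exact absurd hc ha
      · simp [hc, hac]
    rw [h.codeg_eq hs ha hc]
    by_cases hac : a = c
    · subst hac; simp; ring
    · simp [hac]; ring
  unfold c4Weight
  simp_rw [key, Finset.sum_add_distrib, Finset.sum_sub_distrib, Finset.sum_add_distrib,
    ← Finset.mul_sum, ← Finset.sum_mul]
  simp only [Finset.sum_ite_eq, Finset.mem_univ, if_true, Finset.sum_sub_distrib, hs,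
    ← Finset.mul_sum]
  ring

lemma CliqueSupported.coCherryWeight_eq {x : V → ℝ} (h : CliqueSupported G x) :
    coCherryWeight G x = 0 := by
  refine Finset.sum_eq_zero fun a _ => Finset.sum_eq_zero fun b _ => Finset.sum_eq_zero fun c _ => ?_
  by_cases ha : x a = 0
  · simp [ha]
  by_cases hb : x b = 0
  · simp [hb]
  by_cases hc : x c = 0
  · simp [hc]
  unfold coCherryInd
  by_cases hac : a = c
  · by_cases hbc : b = c
    · subst hac; subst hbc; simp
    · rw [adjInd_of_adj (h b c hb hc hbc)]; simp
  · rw [adjInd_of_adj (h a c ha hc hac)]; simp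

lemma sum_comp_sub_eq_of_eqOn {x y : V → ℝ} {u v : V} (huv : u ≠ v)
    (h : ∀ a, a ≠ u → a ≠ v → y a = x a) (f : ℝ → ℝ) :
    ∑ a, f (y a) = ∑ a, f (x a) + (f (y u) - f (x u)) + (f (y v) - f (x v)) := by
  have : ∑ a, (f (y a) - f (x a)) = (f (y u) - f (x u)) + (f (y v) - f (x v)) :=
    Fintype.sum_eq_add u v huv fun a ha => by rw [h a ha.1 ha.2, sub_self]
  rw [Finset.sum_sub_distrib] at this
  linarith

/-- With all other weights and `s = x u + x v` fixed, the value depends on `p = x u * x v` as a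
constant plus `2p² + p(8 - 8A + 4s² - 12s)`. This is strictly increasing for `p ≥ 0`, so replacing
unequal weights by their mean would improve it. -/
lemma CliqueSupported.eq_of_isMaxOn {x : V → ℝ} (h : CliqueSupported G x)
    (hx : x ∈ stdSimplex ℝ V) (hmax : IsMaxOn (mixedWeight G) (stdSimplex ℝ V) x)
    {u v : V} (hu : x u ≠ 0) (hv : x v ≠ 0) : x u = x v := by
  by_contra hne
  have huv : u ≠ v := fun e => hne (by rw [e])
  have hu0 : 0 < x u := lt_of_le_of_ne (hx.1 u) hu.symm
  have hv0 : 0 < x v := lt_of_le_of_ne (hx.1 v) hv.symm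
  set m := (x u + x v) / 2 with hm
  set y : V → ℝ := fun a => if a = u ∨ a = v then m else x a with hy
  have yu : y u = m := by simp [hy]
  have yv : y v = m := by simp [hy]
  have yo : ∀ a, a ≠ u → a ≠ v → y a = x a := fun a h1 h2 => by simp [hy, h1, h2]
  have hm0 : 0 < m := by positivity
  have hsum := sum_comp_sub_eq_of_eqOn huv yo
  have ysum : ∑ a, y a = 1 := by
    have := hsum id
    simp only [id] at this
    rw [this, hx.2, yu, yv, hm]; ring
  have hyx : ∀ a, y a ≠ 0 → x a ≠ 0 := by
    intro a ha
    by_cases h1 : a = u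
    · subst h1; exact hu
    by_cases h2 : a = v
    · subst h2; exact hv
    rwa [← yo a h1 h2]
  have hyS : y ∈ stdSimplex ℝ V := by
    refine ⟨fun a => ?_, ysum⟩
    by_cases h1 : a = u
    · subst h1; rw [yu]; exact hm0.le
    by_cases h2 : a = v
    · subst h2; rw [yv]; exact hm0.le
    rw [yo a h1 h2]; exact hx.1 a
  have hyc : CliqueSupported G y := fun a b ha hb hab => h a b (hyx a ha) (hyx b hb) hab
  have hle : mixedWeight G y ≤ mixedWeight G x := hmax hyS
  rw [mixedWeight, mixedWeight, hyc.coCherryWeight_eq, h.coCherryWeight_eq,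
    hyc.c4Weight_eq ysum, h.c4Weight_eq hx.2, hsum (fun t => t ^ 2), hsum (fun t => t ^ 3),
    hsum (fun t => t ^ 4)] at hle
  simp only [yu, yv] at hle
  have hrest : ∑ a, x a ^ 2 - x u ^ 2 - x v ^ 2 ≤ (1 - x u - x v) ^ 2 := by
    have e1 : ∑ a ∈ Finset.univ \ {u, v}, x a ^ 2 = ∑ a, x a ^ 2 - x u ^ 2 - x v ^ 2 := by
      rw [← Finset.sum_sdiff (Finset.subset_univ {u, v}), Finset.sum_pair huv]; ring
    have e2 : ∑ a ∈ Finset.univ \ {u, v}, x a = 1 - x u - x v := by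
      rw [← hx.2, ← Finset.sum_sdiff (Finset.subset_univ {u, v}), Finset.sum_pair huv]; ring
    rw [← e1, ← e2]
    exact Finset.sum_sq_le_sq_sum_of_nonneg fun i _ => hx.1 i
  have hs1 : x u + x v ≤ 1 := by
    rw [← hx.2, ← Finset.sum_pair huv]
    exact Finset.sum_le_sum_of_subset_of_nonneg (Finset.subset_univ _) fun i _ _ => hx.1 i
  obtain ⟨A, hA⟩ : ∃ A, A = ∑ a, x a ^ 2 - x u ^ 2 - x v ^ 2 := ⟨_, rfl⟩
  rw [← hA] at hrest
  have hA' : ∑ a, x a ^ 2 = A + x u ^ 2 + x v ^ 2 := by linarith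
  rw [hA'] at hle
  set s := x u + x v with hsd
  set p := x u * x v with hp
  have hp0 : 0 < p := mul_pos hu0 hv0
  have hpm : p < m ^ 2 := by
    have : 0 < (x u - x v) ^ 2 := sq_pos_of_ne_zero (sub_ne_zero.2 hne)
    rw [hm, hp]; nlinarith
  -- From `A ≤ (1 - s)²` the left-over is at least `4s(1 - s)`.
  have hcoef : 0 ≤ 8 - 8 * A + 4 * s ^ 2 - 12 * s := by nlinarith
  have hdiff : 2 * (m ^ 2) ^ 2 + m ^ 2 * (8 - 8 * A + 4 * s ^ 2 - 12 * s) ≤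
      2 * p ^ 2 + p * (8 - 8 * A + 4 * s ^ 2 - 12 * s) := by
    have hv' : x v = s - x u := by rw [hsd]; ring
    have hms : m = s / 2 := hm
    rw [hms, hp, hv']
    rw [hms, hv'] at hle
    nlinarith
  have := mul_le_mul_of_nonneg_right hpm.le hcoef
  nlinarith

/-- In a `K_{r+1}`-free graph the mixed weight is at most the value of the balanced complete
`r`-partite graph. -/
theorem mixedWeight_le_turanC4 {r : ℕ} (hr : 3 ≤ r) (hG : G.CliqueFree (r + 1)) {x : V → ℝ}
    (hx : x ∈ stdSimplex ℝ V) : mixedWeight G x ≤ turanC4 r := by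
  by_contra hlt
  push Not at hlt
  have hf : 2 / 9 ≤ turanC4 (r : ℝ) := two_ninths_le_turanC4 (by exact_mod_cast hr)
  have : Nonempty V := by
    by_contra hV
    rw [not_nonempty_iff] at hV
    have := hx.2
    simp at this
  obtain ⟨y, hy, hmax, hcl⟩ := exists_isMaxOn_clique (G := G) ⟨x, hx, hf.trans hlt.le⟩
  have hcl : CliqueSupported G y := hcl
  refine absurd ((hmax hx).trans ?_) (not_le.2 hlt)
  obtain ⟨u, hu⟩ : ∃ u, y u ≠ 0 := by
    by_contra hall
    push Not at hall
    have := hy.2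
    simp [hall] at this
  have hS : (suppF y).card ≤ r := by
    by_contra hk
    push Not at hk
    refine hG.mono hk (suppF y) ⟨fun a ha b hb hab => ?_, rfl⟩
    exact hcl a b (mem_suppF.1 ha) (mem_suppF.1 hb) hab
  have hk0 : 0 < (suppF y).card := Finset.card_pos.2 ⟨u, mem_suppF.2 hu⟩
  have hval : ∀ a ∈ suppF y, y a = y u := fun a ha =>
    hcl.eq_of_isMaxOn hy hmax (mem_suppF.1 ha) hu
  have hpow : ∀ n : ℕ, n ≠ 0 → ∑ a, y a ^ n = (suppF y).card * y u ^ n := by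
    intro n hn
    rw [← Finset.sum_subset (Finset.subset_univ (suppF y)) fun a _ ha => by
      rw [mem_suppF, not_not] at ha; simp [ha, hn], Finset.sum_congr rfl fun a ha => by
      rw [hval a ha], Finset.sum_const, nsmul_eq_mul]
  have hk : ((suppF y).card : ℝ) ≠ 0 := by exact_mod_cast hk0.ne'
  have hyu : y u = ((suppF y).card : ℝ)⁻¹ := by
    have := hpow 1 one_ne_zero
    simp only [pow_one] at this
    rw [hy.2] at this
    field_simp
    linarith
  refine le_trans (le_of_eq ?_) (turanC4_mono (by exact_mod_cast hk0)
    (show ((suppF y).card : ℝ) ≤ r by exact_mod_cast hS))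
  rw [mixedWeight, hcl.coCherryWeight_eq, hcl.c4Weight_eq hy.2, hpow 2 two_ne_zero,
    hpow 3 three_ne_zero, hpow 4 four_ne_zero, turanC4_eq hk, hyu]
  field_simp
  ring

end CliqueWeights

/-! ### Transfer to graphs with few copies of `K_{r+1}` by random sampling. -/

section Sampling

open scoped BigOperators

/-- The restriction of a uniform random map to a set of distinct coordinates is again uniform. -/
lemma expect_comp_injective {α β V : Type*} [Fintype α] [Fintype β] [DecidableEq α]
    [DecidableEq β] [Fintype V] [Nonempty V] {ι : α → β} (hι : Function.Injective ι)
    (g : (α → V) → ℝ) : 𝔼 φ : β → V, g (φ ∘ ι) = 𝔼 ψ : α → V, g ψ := by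
  classical
  let e : (β → V) ≃ (α → V) × ({b // ¬ b ∈ Set.range ι} → V) :=
    (Equiv.piEquivPiSubtypeProd (· ∈ Set.range ι) fun _ => V).trans
      (Equiv.prodCongr ((Equiv.ofInjective ι hι).symm.arrowCongr (Equiv.refl V)) (Equiv.refl _))
  have he : ∀ φ : β → V, (e φ).1 = φ ∘ ι := fun φ => by
    ext a
    simp [e]
  have h1 : 𝔼 φ : β → V, g (φ ∘ ι) =
      𝔼 p : (α → V) × ({b // ¬ b ∈ Set.range ι} → V), g p.1 :=
    Fintype.expect_equiv e _ _ fun φ => by rw [he]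
  rw [h1, ← Finset.univ_product_univ, Finset.expect_product]
  simp

variable {V : Type*} [Fintype V]

/-- The weight of a labelled closed walk of length four. -/
noncomputable def c4Ind (G : SimpleGraph V) (f : Fin 4 → V) : ℝ :=
  adjInd G (f 0) (f 1) * adjInd G (f 1) (f 2) * adjInd G (f 2) (f 3) * adjInd G (f 3) (f 0)

lemma c4Ind_nonneg (G : SimpleGraph V) (f : Fin 4 → V) : 0 ≤ c4Ind G f :=
  mul_nonneg (mul_nonneg (mul_nonneg (adjInd_nonneg _ _) (adjInd_nonneg _ _))
    (adjInd_nonneg _ _)) (adjInd_nonneg _ _)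

lemma sum_fin_three (f : (Fin 3 → V) → ℝ) :
    ∑ p, f p = ∑ a, ∑ b, ∑ c, f ![a, b, c] := by
  let e : (Fin 3 → V) ≃ V × V × V :=
    { toFun := fun p => (p 0, p 1, p 2)
      invFun := fun q => ![q.1, q.2.1, q.2.2]
      left_inv := fun p => by ext i; fin_cases i <;> rfl
      right_inv := fun q => rfl }
  rw [Fintype.sum_equiv e f (fun q => f ![q.1, q.2.1, q.2.2]) fun p => by
    rw [show ![(e p).1, (e p).2.1, (e p).2.2] = p from e.left_inv p]]
  simp_rw [Fintype.sum_prod_type]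

lemma sum_fin_four (f : (Fin 4 → V) → ℝ) :
    ∑ p, f p = ∑ a, ∑ b, ∑ c, ∑ d, f ![a, b, c, d] := by
  let e : (Fin 4 → V) ≃ V × V × V × V :=
    { toFun := fun p => (p 0, p 1, p 2, p 3)
      invFun := fun q => ![q.1, q.2.1, q.2.2.1, q.2.2.2]
      left_inv := fun p => by ext i; fin_cases i <;> rfl
      right_inv := fun q => rfl }
  rw [Fintype.sum_equiv e f (fun q => f ![q.1, q.2.1, q.2.2.1, q.2.2.2]) fun p => by
    rw [show ![(e p).1, (e p).2.1, (e p).2.2.1, (e p).2.2.2] = p from e.left_inv p]]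
  simp_rw [Fintype.sum_prod_type]

lemma c4Weight_const (G : SimpleGraph V) (w : ℝ) :
    c4Weight G (fun _ => w) = w ^ 4 * ∑ f, c4Ind G f := by
  rw [sum_fin_four, c4Weight, Finset.mul_sum]
  refine Finset.sum_congr rfl fun a _ => ?_
  rw [Finset.sum_comm, Finset.mul_sum]
  refine Finset.sum_congr rfl fun c _ => ?_
  simp only [codeg, sq, ← Finset.mul_sum]
  simp only [c4Ind, Finset.mul_sum, Finset.sum_mul]
  refine Finset.sum_congr rfl fun b _ => Finset.sum_congr rfl fun d _ => ?_
  simp only [Matrix.cons_val]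
  rw [adjInd_comm d a, adjInd_comm c d]
  ring

lemma coCherryWeight_const (G : SimpleGraph V) (w : ℝ) :
    coCherryWeight G (fun _ => w) =
      w ^ 3 * ∑ f : Fin 3 → V, coCherryInd G (f 0) (f 1) (f 2) := by
  rw [sum_fin_three, coCherryWeight]
  simp only [Finset.mul_sum, Matrix.cons_val]
  exact Finset.sum_congr rfl fun a _ => Finset.sum_congr rfl fun b _ =>
    Finset.sum_congr rfl fun c _ => by ring

/-- The homomorphism density of `C₄`. -/
noncomputable def c4Density (G : SimpleGraph V) : ℝ := 𝔼 f, c4Ind G f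

/-- The density of labelled induced co-cherries. -/
noncomputable def coCherryDensity (G : SimpleGraph V) : ℝ :=
  𝔼 f : Fin 3 → V, coCherryInd G (f 0) (f 1) (f 2)

open Classical in
/-- The homomorphism density of the complete graph on `s` vertices. -/
noncomputable def cliqueDensity (G : SimpleGraph V) (s : ℕ) : ℝ :=
  𝔼 f : Fin s → V, if Pairwise fun i j => G.Adj (f i) (f j) then 1 else 0

lemma c4Weight_const_inv_card (G : SimpleGraph V) :
    c4Weight G (fun _ => (Fintype.card V : ℝ)⁻¹) = c4Density G := by
  rw [c4Weight_const, c4Density, Fintype.expect_eq_sum_div_card, div_eq_inv_mul]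
  simp

lemma coCherryWeight_const_inv_card (G : SimpleGraph V) :
    coCherryWeight G (fun _ => (Fintype.card V : ℝ)⁻¹) = coCherryDensity G := by
  rw [coCherryWeight_const, coCherryDensity, Fintype.expect_eq_sum_div_card, div_eq_inv_mul]
  simp

lemma const_mem_stdSimplex [Nonempty V] :
    (fun _ => (Fintype.card V : ℝ)⁻¹) ∈ stdSimplex ℝ V :=
  ⟨fun _ => by positivity, by simp⟩

lemma c4Weight_le_one {G : SimpleGraph V} {x : V → ℝ} (hx : x ∈ stdSimplex ℝ V) :
    c4Weight G x ≤ 1 := by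
  have : (1 : ℝ) = ∑ a, ∑ c, x a * x c := by
    simp_rw [← Finset.mul_sum, ← Finset.sum_mul, hx.2, one_mul]
  rw [this]
  exact Finset.sum_le_sum fun a _ => Finset.sum_le_sum fun c _ =>
    mul_le_of_le_one_right (mul_nonneg (hx.1 a) (hx.1 c))
      (pow_le_one₀ (codeg_nonneg hx.1 _ _) (codeg_le_one hx _ _))

lemma mixedWeight_le_two {G : SimpleGraph V} {x : V → ℝ} (hx : x ∈ stdSimplex ℝ V) :
    mixedWeight G x ≤ 2 := by
  classical
  have h1 := c4Weight_le_one (G := G) hx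
  have h2 := coCherryWeight_le (G := G) hx.1
  rw [hx.2, one_pow] at h2
  unfold mixedWeight
  linarith

/-- Each injective `ι` contributes exactly the expectation of `g`; the other `ι` are dropped by
nonnegativity. -/
lemma descFactorial_mul_expect_le [Nonempty V] {s : ℕ} (m : ℕ) {g : (Fin s → V) → ℝ}
    (hg : ∀ f, 0 ≤ g f) :
    (m.descFactorial s : ℝ) * 𝔼 f, g f ≤ 𝔼 φ : Fin m → V, ∑ ι : Fin s → Fin m, g (φ ∘ ι) := by
  classical
  rw [Finset.expect_sum_comm]
  have hc : (m.descFactorial s : ℝ) =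
      (Finset.univ.filter fun ι : Fin s → Fin m => Function.Injective ι).card := by
    have := Fintype.card_embedding_eq (α := Fin s) (β := Fin m)
    rw [Fintype.card_fin, Fintype.card_fin] at this
    rw [← this, ← Fintype.card_congr (Equiv.subtypeInjectiveEquivEmbedding (Fin s) (Fin m)),
      Fintype.card_subtype]
  rw [hc, ← nsmul_eq_mul, ← Finset.sum_const]
  refine le_trans (le_of_eq ?_) (Finset.sum_le_sum_of_subset_of_nonneg (Finset.filter_subset
    (fun ι : Fin s → Fin m => Function.Injective ι) Finset.univ) fun ι _ _ =>
      Finset.expect_nonneg fun φ _ => hg _)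
  exact Finset.sum_congr rfl fun ι hι =>
    (expect_comp_injective (Finset.mem_filter.1 hι).2 g).symm

/-- Union bound over the at most `m ^ s` possible positions of a clique in the sample. -/
lemma expect_not_cliqueFree_le [Nonempty V] (G : SimpleGraph V) (s m : ℕ) [DecidablePred fun
    φ : Fin m → V => (G.comap φ).CliqueFree s] :
    (𝔼 φ : Fin m → V, if (G.comap φ).CliqueFree s then (0 : ℝ) else 1) ≤
      (m : ℝ) ^ s * cliqueDensity G s := by
  classical
  set g : (Fin s → V) → ℝ := fun f => if Pairwise fun i j => G.Adj (f i) (f j) then 1 else 0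
    with hg
  have hg0 : ∀ f, 0 ≤ g f := fun f => by simp only [hg]; split_ifs <;> norm_num
  have hd0 : 0 ≤ cliqueDensity G s := Finset.expect_nonneg fun _ _ => by split_ifs <;> norm_num
  calc (𝔼 φ : Fin m → V, if (G.comap φ).CliqueFree s then (0 : ℝ) else 1)
      ≤ 𝔼 φ : Fin m → V, ∑ ι ∈ Finset.univ.filter
          (fun ι : Fin s → Fin m => Function.Injective ι), g (φ ∘ ι) := by
        refine Finset.expect_le_expect fun φ _ => ?_
        split_ifs with h
        · exact Finset.sum_nonneg fun ι _ => hg0 _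
        · rw [cliqueFree_iff, not_isEmpty_iff] at h
          obtain ⟨ι⟩ := h
          refine le_trans (le_of_eq ?_) (Finset.single_le_sum (fun ι _ => hg0 (φ ∘ ι))
            (Finset.mem_filter.2 ⟨Finset.mem_univ (ι : Fin s → Fin m), ι.injective⟩))
          simp only [hg]
          rw [if_pos]
          intro i j hij
          have : (G.comap φ).Adj (ι i) (ι j) := ι.toHom.map_adj (by simpa using hij)
          exact this
    _ = ∑ ι ∈ Finset.univ.filter (fun ι : Fin s → Fin m => Function.Injective ι),
          𝔼 φ : Fin m → V, g (φ ∘ ι) := Finset.expect_sum_comm _ _ _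
    _ = ∑ ι ∈ Finset.univ.filter (fun ι : Fin s → Fin m => Function.Injective ι),
          cliqueDensity G s := Finset.sum_congr rfl fun ι hι =>
        expect_comp_injective (Finset.mem_filter.1 hι).2 g
    _ ≤ ∑ ι : Fin s → Fin m, cliqueDensity G s :=
        Finset.sum_le_sum_of_subset_of_nonneg (Finset.filter_subset _ _) fun _ _ _ => hd0
    _ = (m : ℝ) ^ s * cliqueDensity G s := by simp

/-- Average `mixedWeight_le_turanC4` with uniform weights over the samples `G.comap φ`. Samples that
contain `K_{r+1}` are charged the trivial bound 2. -/
lemma descFactorial_mul_densities_le [Nonempty V] (G : SimpleGraph V) {r m : ℕ} (hr : 3 ≤ r)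
    (hm : 0 < m) :
    (m.descFactorial 4 : ℝ) / m ^ 4 * c4Density G +
      (m.descFactorial 3 : ℝ) / m ^ 3 * coCherryDensity G / 27 ≤
      turanC4 r + 2 * (m ^ (r + 1) * cliqueDensity G (r + 1)) := by
  classical
  have : Nonempty (Fin m) := ⟨⟨0, hm⟩⟩
  have hm0 : (0 : ℝ) < m := by exact_mod_cast hm
  have h4 := descFactorial_mul_expect_le m (c4Ind_nonneg G)
  have h3 := descFactorial_mul_expect_le m
    (fun f : Fin 3 → V => coCherryInd_nonneg (G := G) (f 0) (f 1) (f 2))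
  have hpt : ∀ φ : Fin m → V,
      (m : ℝ)⁻¹ ^ 4 * ∑ ι : Fin 4 → Fin m, c4Ind G (φ ∘ ι) +
      (m : ℝ)⁻¹ ^ 3 * (∑ ι : Fin 3 → Fin m, coCherryInd G (φ (ι 0)) (φ (ι 1)) (φ (ι 2))) / 27 ≤
      turanC4 r + 2 * (if (G.comap φ).CliqueFree (r + 1) then (0 : ℝ) else 1) := by
    intro φ
    have e : mixedWeight (G.comap φ) (fun _ => (Fintype.card (Fin m) : ℝ)⁻¹) =
        (m : ℝ)⁻¹ ^ 4 * ∑ ι : Fin 4 → Fin m, c4Ind G (φ ∘ ι) +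
        (m : ℝ)⁻¹ ^ 3 * (∑ ι : Fin 3 → Fin m,
          coCherryInd G (φ (ι 0)) (φ (ι 1)) (φ (ι 2))) / 27 := by
      rw [mixedWeight, c4Weight_const, coCherryWeight_const, Fintype.card_fin]
      rfl
    rw [← e]
    split_ifs with h
    · simpa using mixedWeight_le_turanC4 hr h const_mem_stdSimplex
    · have h1 := mixedWeight_le_two (G := G.comap φ) const_mem_stdSimplex
      have h2 : 2 / 9 ≤ turanC4 (r : ℝ) := two_ninths_le_turanC4 (by exact_mod_cast hr)
      linarith
  have hav := Finset.expect_le_expect fun φ (_ : φ ∈ Finset.univ) => hpt φ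
  rw [Finset.expect_add_distrib, Finset.expect_add_distrib, ← Finset.expect_div,
    ← Finset.mul_expect, ← Finset.mul_expect, ← Finset.mul_expect,
    Fintype.expect_const] at hav
  have hb := expect_not_cliqueFree_le G (r + 1) m
  have i4 : (m.descFactorial 4 : ℝ) / m ^ 4 * c4Density G ≤
      (m : ℝ)⁻¹ ^ 4 * 𝔼 φ : Fin m → V, ∑ ι : Fin 4 → Fin m, c4Ind G (φ ∘ ι) := by
    rw [div_eq_inv_mul, ← inv_pow, mul_assoc]
    exact mul_le_mul_of_nonneg_left h4 (by positivity)
  have i3 : (m.descFactorial 3 : ℝ) / m ^ 3 * coCherryDensity G ≤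
      (m : ℝ)⁻¹ ^ 3 * 𝔼 φ : Fin m → V, ∑ ι : Fin 3 → Fin m,
        coCherryInd G (φ (ι 0)) (φ (ι 1)) (φ (ι 2)) := by
    rw [div_eq_inv_mul, ← inv_pow, mul_assoc]
    exact mul_le_mul_of_nonneg_left h3 (by positivity)
  linarith

lemma one_sub_div_le_descFactorial_div (m : ℕ) (hm : 4 ≤ m) :
    1 - 6 / (m : ℝ) ≤ (m.descFactorial 4 : ℝ) / m ^ 4 ∧
      1 - 3 / (m : ℝ) ≤ (m.descFactorial 3 : ℝ) / m ^ 3 := by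
  have hm0 : (0 : ℝ) < m := by exact_mod_cast (by omega : 0 < m)
  have hm4 : (4 : ℝ) ≤ m := by exact_mod_cast hm
  have e3 : (m.descFactorial 3 : ℝ) = m * (m - 1) * (m - 2) := by
    simp only [Nat.descFactorial, Nat.sub_zero]
    push_cast [show 2 ≤ m by omega, show 1 ≤ m by omega]
    ring
  have e4 : (m.descFactorial 4 : ℝ) = m * (m - 1) * (m - 2) * (m - 3) := by
    rw [Nat.descFactorial_succ, Nat.cast_mul, e3]
    push_cast [show 3 ≤ m by omega]
    ring
  rw [e3, e4, le_div_iff₀ (by positivity), le_div_iff₀ (by positivity)]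
  constructor
  · have : (1 - 6 / (m : ℝ)) * m ^ 4 = (m - 6) * m ^ 3 := by field_simp
    rw [this]
    nlinarith [mul_nonneg hm0.le (sub_nonneg.2 hm4)]
  · have : (1 - 3 / (m : ℝ)) * m ^ 3 = (m - 3) * m ^ 2 := by field_simp
    rw [this]
    nlinarith

lemma c4Density_nonneg (G : SimpleGraph V) : 0 ≤ c4Density G :=
  Finset.expect_nonneg fun f _ => c4Ind_nonneg G f

lemma coCherryDensity_nonneg (G : SimpleGraph V) : 0 ≤ coCherryDensity G :=
  Finset.expect_nonneg fun _ _ => coCherryInd_nonneg _ _ _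

/-- A graph with few copies of `K_{r+1}` has `C₄` and co-cherry densities close to those allowed
for `K_{r+1}`-free graphs. -/
theorem exists_cliqueDensity_bound {r : ℕ} (hr : 3 ≤ r) {ε : ℝ} (hε : 0 < ε) :
    ∃ κ : ℝ, 0 < κ ∧ ∀ (n : ℕ) (G : SimpleGraph (Fin n)), 0 < n →
      cliqueDensity G (r + 1) ≤ κ →
      c4Density G + coCherryDensity G / 27 ≤ turanC4 r + ε := by
  -- The falling factorials cost at most `6/m + (3/m)/27 < 7/m < ε/2`; the choice of `κ` lets the
  -- bad samples cost the other `ε/2`.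
  obtain ⟨m, hm⟩ := exists_nat_gt (max 4 (14 / ε))
  have hm4' : (4 : ℝ) < m := (le_max_left _ _).trans_lt hm
  have hm4 : 4 ≤ m := by exact_mod_cast hm4'.le
  have hme : 14 / ε < m := (le_max_right _ _).trans_lt hm
  have hm0 : (0 : ℝ) < m := by linarith
  refine ⟨ε / (4 * m ^ (r + 1)), by positivity, fun n G hn hκ => ?_⟩
  have : Nonempty (Fin n) := ⟨⟨0, hn⟩⟩
  have h := descFactorial_mul_densities_le G hr (show 0 < m by omega)
  obtain ⟨d4, d3⟩ := one_sub_div_le_descFactorial_div m hm4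
  have c4 : c4Density G ≤ 1 := by
    rw [← c4Weight_const_inv_card]
    exact c4Weight_le_one const_mem_stdSimplex
  have c3 : coCherryDensity G ≤ 1 := by
    rw [← coCherryWeight_const_inv_card]
    have := coCherryWeight_le (G := G) (const_mem_stdSimplex (V := Fin n)).1
    rwa [(const_mem_stdSimplex (V := Fin n)).2, one_pow] at this
  have c40 := c4Density_nonneg G
  have c30 := coCherryDensity_nonneg G
  have hk : (m : ℝ) ^ (r + 1) * cliqueDensity G (r + 1) ≤ ε / 4 := by
    refine (mul_le_mul_of_nonneg_left hκ (by positivity)).trans (le_of_eq ?_)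
    field_simp
  have hme' : 14 / (m : ℝ) < ε := by
    rw [div_lt_iff₀ hε] at hme
    rw [div_lt_iff₀ hm0]
    linarith
  have j4 := mul_le_mul_of_nonneg_right d4 c40
  have j3 := mul_le_mul_of_nonneg_right d3 c30
  have k0 : 0 < 1 / (m : ℝ) := by positivity
  have e6 : 6 / (m : ℝ) = 6 * (1 / m) := by ring
  have e3 : 3 / (m : ℝ) = 3 * (1 / m) := by ring
  have e14 : 14 / (m : ℝ) = 14 * (1 / m) := by ring
  rw [e6] at j4
  rw [e3] at j3
  rw [e14] at hme'
  have l4 := mul_le_mul_of_nonneg_left c4 k0.le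
  have l3 := mul_le_mul_of_nonneg_left c3 k0.le
  linarith

end Sampling

/-! ### Large `F`-free graphs have few cliques. -/

section Supersaturation

open scoped BigOperators

lemma expect_pow_le_expect_pow {ι : Type*} [Fintype ι] [Nonempty ι] {f : ι → ℝ}
    (hf : ∀ i, 0 ≤ f i) (n : ℕ) : (𝔼 i, f i) ^ n ≤ 𝔼 i, f i ^ n := by
  have := Real.pow_arith_mean_le_arith_mean_pow Finset.univ
    (fun _ : ι => (Fintype.card ι : ℝ)⁻¹) f (fun _ _ => by positivity) (by simp)
    (fun i _ => hf i) n
  simpa only [Fintype.expect_eq_sum_div_card, div_eq_inv_mul, ← Finset.mul_sum] using this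

lemma expect_pow_card {W X : Type*} [Fintype W] [DecidableEq W] [Fintype X] (f : X → ℝ) :
    (𝔼 x, f x) ^ Fintype.card W = 𝔼 v : W → X, ∏ w, f (v w) := by
  simp only [Fintype.expect_eq_sum_div_card, div_pow]
  rw [← Finset.card_univ (α := W), ← Finset.prod_const, Finset.prod_univ_sum]
  simp

lemma expect_fin_succ {A : Type*} [Fintype A] {s : ℕ} (f : (Fin (s + 1) → A) → ℝ) :
    𝔼 x, f x = 𝔼 a, 𝔼 y : Fin s → A, f (Fin.cons a y) := by
  have := Fintype.expect_equiv (Fin.consEquiv fun _ : Fin (s + 1) => A)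
    (fun p => f (Fin.cons p.1 p.2)) f fun p => rfl
  rw [← this, ← Finset.univ_product_univ, Finset.expect_product]

/-- Replacing each of `s` variables by `|W|` independent copies: the expectation of a
nonnegative function is controlled by that of its product over all choices of copies. -/
lemma expect_pow_le_expect_prod_blowup.{u} {X : Type} {W : Type u} [Fintype X] [Nonempty X] [Fintype W]
    [DecidableEq W] (s : ℕ) : ∀ (Z : Type u) [Fintype Z] [Nonempty Z]
    (f : (Fin s → X) → Z → ℝ), (∀ x z, 0 ≤ f x z) →
    (𝔼 z, 𝔼 x, f x z) ^ Fintype.card W ^ s ≤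
      𝔼 z, 𝔼 y : Fin s → W → X, ∏ w : Fin s → W, f (fun i => y i (w i)) z := by
  induction s with
  | zero =>
    intro Z _ _ f hf
    simp only [pow_zero, pow_one, Finset.univ_unique, Finset.expect_singleton,
      Finset.prod_singleton]
    refine le_of_eq (Finset.expect_congr rfl fun z _ => ?_)
    congr 1
    exact Subsingleton.elim _ _
  | succ s ih =>
    intro Z _ _ f hf
    -- Jensen in the first variable replaces it by `|W|` independent copies. They join the parameter
    -- space, which is why the induction quantifies over `Z`.
    set F : (Fin s → X) → Z × (W → X) → ℝ := fun x p => ∏ w, f (Fin.cons (p.2 w) x) p.1 with hF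
    have hF0 : ∀ x p, 0 ≤ F x p := fun x p => Finset.prod_nonneg fun w _ => hf _ _
    have h1 : (𝔼 z, 𝔼 x, f x z) ^ Fintype.card W ≤ 𝔼 p, 𝔼 x, F x p := by
      have e1 : 𝔼 z, 𝔼 x, f x z = 𝔼 q : Z × (Fin s → X), 𝔼 a, f (Fin.cons a q.2) q.1 := by
        rw [← Finset.univ_product_univ, Finset.expect_product]
        refine Finset.expect_congr rfl fun z _ => ?_
        rw [expect_fin_succ, Finset.expect_comm]
      have e2 : 𝔼 p, 𝔼 x, F x p = 𝔼 q : Z × (Fin s → X),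
          (𝔼 a, f (Fin.cons a q.2) q.1) ^ Fintype.card W := by
        simp_rw [expect_pow_card]
        rw [← Finset.univ_product_univ, Finset.expect_product, ← Finset.univ_product_univ,
          Finset.expect_product]
        refine Finset.expect_congr rfl fun z _ => ?_
        rw [Finset.expect_comm]
      rw [e1, e2]
      exact expect_pow_le_expect_pow (fun q => Finset.expect_nonneg fun a _ => hf _ _) _
    have h0 : 0 ≤ 𝔼 z, 𝔼 x, f x z :=
      Finset.expect_nonneg fun z _ => Finset.expect_nonneg fun x _ => hf _ _
    rw [pow_succ', pow_mul]
    have h2 := ih (Z × (W → X)) F hF0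
    have h3 := pow_le_pow_left₀ (pow_nonneg h0 _) h1 (Fintype.card W ^ s)
    refine h3.trans (h2.trans (le_of_eq ?_))
    rw [← Finset.univ_product_univ, Finset.expect_product]
    refine Finset.expect_congr rfl fun z _ => ?_
    rw [expect_fin_succ]
    refine Finset.expect_congr rfl fun v _ => Finset.expect_congr rfl fun y _ => ?_
    rw [Finset.prod_comm, ← Fintype.prod_prod_type']
    refine Fintype.prod_equiv (Fin.consEquiv fun _ : Fin (s + 1) => W) _ _ fun p => ?_
    congr 1
    ext i
    refine Fin.cases ?_ (fun j => ?_) i <;> simp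

lemma expect_eq_indicator {n : ℕ} (hn : 0 < n) {s : ℕ} {W : Type*} [Fintype W] [DecidableEq W]
    (i : Fin s) {w w' : W} (hw : w ≠ w') :
    𝔼 y : Fin s → W → Fin n, (if y i w = y i w' then (1 : ℝ) else 0) = (n : ℝ)⁻¹ := by
  have : Nonempty (Fin n) := ⟨⟨0, hn⟩⟩
  have hn0 : (n : ℝ) ≠ 0 := by positivity
  have hι : Function.Injective (![(i, w), (i, w')] : Fin 2 → Fin s × W) := by
    intro a b hab
    fin_cases a <;> fin_cases b <;> simp_all [eq_comm]
  rw [Fintype.expect_equiv (Equiv.curry (Fin s) W (Fin n)).symm _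
    (fun φ => if (φ ∘ ![(i, w), (i, w')]) 0 = (φ ∘ ![(i, w), (i, w')]) 1 then (1 : ℝ) else 0)
    fun y => by simp]
  rw [expect_comp_injective hι fun ψ : Fin 2 → Fin n => if ψ 0 = ψ 1 then (1 : ℝ) else 0,
    Fintype.expect_equiv (finTwoArrowEquiv (Fin n)) _ (fun p => if p.1 = p.2 then (1 : ℝ) else 0)
      fun ψ => by simp, ← Finset.univ_product_univ, Finset.expect_product]
  simp

/-- Erdős: a large graph containing no copy of a fixed `s`-colourable graph has few copies of
`K_s`. -/
theorem exists_cliqueDensity_le_of_free {W : Type*} [Fintype W] {F : SimpleGraph W} {s : ℕ}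
    (hF : F.Colorable s) {κ : ℝ} (hκ : 0 < κ) :
    ∃ n₀ : ℕ, ∀ (n : ℕ) (G : SimpleGraph (Fin n)), n₀ ≤ n → F.Free G →
      cliqueDensity G s ≤ κ := by
  classical
  obtain ⟨C⟩ := hF
  set t := Fintype.card W
  obtain ⟨n₀, hn₀⟩ := exists_nat_gt ((s * (t * t) : ℕ) / κ ^ t ^ s)
  refine ⟨n₀ + 1, fun n G hn hfree => ?_⟩
  by_contra hlt
  push Not at hlt
  have hnpos : 0 < n := by omega
  have : Nonempty (Fin n) := ⟨⟨0, hnpos⟩⟩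
  set f : (Fin s → Fin n) → PUnit → ℝ := fun x _ =>
    if Pairwise fun i j => G.Adj (x i) (x j) then 1 else 0 with hf
  have hf0 : ∀ x z, 0 ≤ f x z := fun x z => by simp only [hf]; split_ifs <;> norm_num
  have hf1 : ∀ x z, f x z ≤ 1 := fun x z => by simp only [hf]; split_ifs <;> norm_num
  have h1 := expect_pow_le_expect_prod_blowup (W := W) s PUnit f hf0
  have e1 : 𝔼 z, 𝔼 x, f x z = cliqueDensity G s := by
    rw [Finset.univ_unique, Finset.expect_singleton]
    rfl
  rw [e1, Finset.univ_unique, Finset.expect_singleton] at h1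
  -- If each part is injective, a nonzero product would be a genuine blow-up of `K_s`, which
  -- contains `F` by its colouring. Otherwise some coincidence already makes the right side at least
  -- 1.
  have hpt : ∀ y : Fin s → W → Fin n, ∏ w : Fin s → W, f (fun i => y i (w i)) default ≤
      ∑ i, ∑ w, ∑ w', if w ≠ w' then (if y i w = y i w' then (1 : ℝ) else 0) else 0 := by
    intro y
    have hnn : ∀ i w w', (0 : ℝ) ≤ if w ≠ w' then (if y i w = y i w' then (1 : ℝ) else 0) else 0 :=
      fun i w w' => by split_ifs <;> norm_num
    by_cases hinj : ∀ i, Function.Injective (y i)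
    · rw [Finset.prod_eq_zero_iff.2]
      · exact Finset.sum_nonneg fun i _ => Finset.sum_nonneg fun w _ =>
          Finset.sum_nonneg fun w' _ => hnn i w w'
      by_contra hall
      push Not at hall
      have hadj : ∀ (i j : Fin s) (w w' : W), i ≠ j → G.Adj (y i w) (y j w') := by
        intro i j w w' hij
        -- One choice of copies that uses `w` in part `i` and `w'` in part `j`.
        have := hall (fun k => if k = i then w else w') (Finset.mem_univ _)
        simp only [hf] at this
        have hp := (ite_ne_right_iff.1 this).1 hij
        simpa [hij.symm] using hp
      refine hfree ⟨⟨⟨fun w => y (C w) w, fun {a b} hab => hadj _ _ _ _ (C.valid hab)⟩, ?_⟩⟩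
      intro a b hab
      change y (C a) a = y (C b) b at hab
      by_cases hc : C a = C b
      · rw [hc] at hab
        exact hinj _ hab
      · exact absurd hab (hadj _ _ _ _ hc).ne
    · push Not at hinj
      obtain ⟨i, hi⟩ := hinj
      simp only [Function.Injective] at hi
      push Not at hi
      obtain ⟨w, w', he, hne⟩ := hi
      refine (Finset.prod_le_one (fun _ _ => hf0 _ default) fun _ _ => hf1 _ default).trans ?_
      calc (1 : ℝ) = if w ≠ w' then (if y i w = y i w' then (1 : ℝ) else 0) else 0 := by
            simp [he, hne]
        _ ≤ ∑ w', if w ≠ w' then (if y i w = y i w' then (1 : ℝ) else 0) else 0 :=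
            Finset.single_le_sum (fun w' _ => hnn i w w') (Finset.mem_univ w')
        _ ≤ ∑ w, ∑ w', if w ≠ w' then (if y i w = y i w' then (1 : ℝ) else 0) else 0 :=
            Finset.single_le_sum (fun w _ => Finset.sum_nonneg fun w' _ => hnn i w w')
              (Finset.mem_univ w)
        _ ≤ _ := Finset.single_le_sum (fun i _ => Finset.sum_nonneg fun w _ =>
              Finset.sum_nonneg fun w' _ => hnn i w w') (Finset.mem_univ i)
  have h2 := h1.trans (Finset.expect_le_expect fun y _ => hpt y)
  have h3 : 𝔼 y : Fin s → W → Fin n, (∑ i, ∑ w, ∑ w',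
      if w ≠ w' then (if y i w = y i w' then (1 : ℝ) else 0) else 0) ≤
      (s * (t * t) : ℕ) * (n : ℝ)⁻¹ := by
    simp_rw [Finset.expect_sum_comm]
    calc _ ≤ ∑ i : Fin s, ∑ w : W, ∑ w' : W, (n : ℝ)⁻¹ := by
          refine Finset.sum_le_sum fun i _ => Finset.sum_le_sum fun w _ =>
            Finset.sum_le_sum fun w' _ => ?_
          by_cases hw : w = w'
          · simp [hw]
          · simp only [ne_eq, hw, not_false_eq_true, if_true]
            exact (expect_eq_indicator hnpos i hw).le
      _ = _ := by
          simp only [Finset.sum_const, Finset.card_univ, Fintype.card_fin, nsmul_eq_mul]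
          push_cast
          ring
  have h4 : κ ^ t ^ s ≤ cliqueDensity G s ^ t ^ s := pow_le_pow_left₀ hκ.le hlt.le _
  have hn' : (n₀ : ℝ) < n := by exact_mod_cast (by omega : n₀ < n)
  have hn0 : (0 : ℝ) < n := by exact_mod_cast hnpos
  have h5 : κ ^ t ^ s ≤ (s * (t * t) : ℕ) * (n : ℝ)⁻¹ := h4.trans (h2.trans h3)
  rw [← div_eq_mul_inv, le_div_iff₀ hn0] at h5
  rw [div_lt_iff₀ (by positivity)] at hn₀
  have h6 := mul_lt_mul_of_pos_left hn' (show 0 < κ ^ t ^ s by positivity)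
  linarith

end Supersaturation

/-! ### From subgraph counts to homomorphism densities. -/

section Counting

/-- Automorphisms of `H` act simply transitively, by precomposition, on the labelled copies with a
given image. -/
lemma Copy.card_fiber_toSubgraph {U V : Type*} {H : SimpleGraph U} {G : SimpleGraph V}
    (f₀ : H.Copy G) :
    Nat.card {f : H.Copy G // f.toSubgraph = f₀.toSubgraph} = Nat.card (H ≃g H) := by
  symm
  refine Nat.card_congr (Equiv.ofBijective
    (fun σ : H ≃g H => (⟨f₀.comp σ.toCopy, ?_⟩ :
      {f : H.Copy G // f.toSubgraph = f₀.toSubgraph})) ⟨?_, ?_⟩)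
  · refine Subgraph.ext ?_ ?_
    · ext v
      simp only [Copy.toSubgraph, Subgraph.map_verts, Subgraph.verts_top, Set.image_univ]
      exact Set.ext_iff.1 (σ.surjective.range_comp f₀) v
    · ext a b
      simp only [Copy.toSubgraph, Subgraph.map_adj, Relation.Map, Subgraph.top_adj]
      constructor
      · rintro ⟨x, y, hxy, rfl, rfl⟩
        exact ⟨σ x, σ y, σ.map_rel_iff.2 hxy, rfl, rfl⟩
      · rintro ⟨x, y, hxy, rfl, rfl⟩
        refine ⟨σ.symm x, σ.symm y, σ.symm.map_rel_iff.2 hxy, ?_, ?_⟩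
        · exact congrArg f₀ (σ.apply_symm_apply x)
        · exact congrArg f₀ (σ.apply_symm_apply y)
  · intro σ τ h
    have h' := congrArg Subtype.val h
    ext a
    exact f₀.injective (DFunLike.congr_fun h' a)
  · rintro ⟨f, hf⟩
    have hr : Set.range f = Set.range f₀ := by
      simpa [Copy.toSubgraph] using congrArg Subgraph.verts hf
    have hadj : ∀ (g : H.Copy G) x y, g.toSubgraph.Adj (g x) (g y) ↔ H.Adj x y := by
      intro g x y
      simp only [Copy.toSubgraph, Subgraph.map_adj, Relation.Map, Subgraph.top_adj]
      constructor
      · rintro ⟨x', y', h, hx, hy⟩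
        rwa [← g.injective hx, ← g.injective hy]
      · exact fun h => ⟨x, y, h, rfl, rfl⟩
    let τ : U ≃ U := (Equiv.ofInjective f f.injective).trans
      ((Equiv.setCongr hr).trans (Equiv.ofInjective f₀ f₀.injective).symm)
    have hτ : ∀ a, f₀ (τ a) = f a := fun a =>
      congrArg Subtype.val ((Equiv.ofInjective f₀ f₀.injective).apply_symm_apply
        (Equiv.setCongr hr (Equiv.ofInjective f f.injective a)))
    refine ⟨⟨τ, fun {a b} => ?_⟩, Subtype.ext (DFunLike.ext _ _ hτ)⟩
    rw [← hadj f₀, hτ, hτ, ← hf, hadj]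

/-- Labelled copies are counted `|Aut H|` times by unlabelled ones. -/
lemma labelledCopyCount_eq_mul {U V : Type*} [Fintype U] [Fintype V] (H : SimpleGraph U)
    (G : SimpleGraph V) :
    G.labelledCopyCount H = Nat.card (H ≃g H) * G.copyCount H := by
  classical
  rw [copyCount_eq_card_image_copyToSubgraph, labelledCopyCount, ← Finset.card_univ,
    Finset.card_eq_sum_card_image Copy.toSubgraph, mul_comm, ← smul_eq_mul]
  refine Finset.sum_eq_card_nsmul fun S hS => ?_
  obtain ⟨f₀, -, rfl⟩ := Finset.mem_image.1 hS
  rw [← Copy.card_fiber_toSubgraph f₀, Nat.card_eq_fintype_card, Fintype.card_subtype]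

lemma card_aut_C4 : Nat.card (C4 ≃g C4) = 8 := by
  let e : (C4 ≃g C4) ≃ {σ : Equiv.Perm (Fin 4) // ∀ a b, C4.Adj (σ a) (σ b) ↔ C4.Adj a b} :=
    { toFun := fun σ => ⟨σ.toEquiv, fun a b => σ.map_rel_iff⟩
      invFun := fun σ => ⟨σ.1, fun {a b} => σ.2 a b⟩
      left_inv := fun _ => rfl
      right_inv := fun _ => rfl }
  rw [Nat.card_congr e, Nat.card_eq_fintype_card]
  decide +kernel

lemma C4_adj_iff (a b : Fin 4) : C4.Adj a b ↔ b = a + 1 ∨ a = b + 1 := by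
  revert a b; decide

variable {V : Type*} [Fintype V]

lemma c4Ind_eq_one_or (G : SimpleGraph V) (f : Fin 4 → V) :
    c4Ind G f = 0 ∨ (c4Ind G f = 1 ∧ ∀ i j, C4.Adj i j → G.Adj (f i) (f j)) := by
  by_cases h : G.Adj (f 0) (f 1) ∧ G.Adj (f 1) (f 2) ∧ G.Adj (f 2) (f 3) ∧ G.Adj (f 3) (f 0)
  · obtain ⟨h0, h1, h2, h3⟩ := h
    refine Or.inr ⟨by simp [c4Ind, adjInd_of_adj, h0, h1, h2, h3], fun i j hij => ?_⟩
    rcases (C4_adj_iff i j).1 hij with rfl | rfl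
    · fin_cases i <;> assumption
    · fin_cases j <;> (refine G.adj_symm ?_; assumption)
  · left
    simp only [not_and_or] at h
    rcases h with h | h | h | h <;> simp [c4Ind, adjInd_of_not_adj h]

lemma c4Ind_copy (G : SimpleGraph V) (f : Copy C4 G) : c4Ind G f = 1 := by
  have h : ∀ i, G.Adj (f i) (f (i + 1)) := fun i =>
    f.toHom.map_adj ((C4_adj_iff _ _).2 (Or.inl rfl))
  simp [c4Ind, adjInd_of_adj (show G.Adj (f 0) (f 1) from h 0),
    adjInd_of_adj (show G.Adj (f 1) (f 2) from h 1),
    adjInd_of_adj (show G.Adj (f 2) (f 3) from h 2),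
    adjInd_of_adj (show G.Adj (f 3) (f 0) from h 3)]

lemma labelledCopyCount_C4_eq (G : SimpleGraph V)
    [DecidablePred fun f : Fin 4 → V => Function.Injective f] : (G.labelledCopyCount C4 : ℝ) =
    ∑ f ∈ Finset.univ.filter (fun f : Fin 4 → V => Function.Injective f), c4Ind G f := by
  classical
  let φ : Copy C4 G → Fin 4 → V := fun f => f
  have e : (G.labelledCopyCount C4 : ℝ) =
      ∑ f ∈ (Finset.univ : Finset (Copy C4 G)).image φ, c4Ind G f := by
    rw [Finset.sum_image fun f _ g _ h => DFunLike.coe_injective h]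
    change _ = ∑ f : Copy C4 G, c4Ind G f
    simp only [c4Ind_copy, labelledCopyCount, Finset.sum_const, Finset.card_univ, nsmul_eq_mul,
      mul_one]
    congr!
  rw [e]
  refine Finset.sum_subset (fun f hf => ?_) fun f hf hf' => ?_
  · obtain ⟨g, -, rfl⟩ := Finset.mem_image.1 hf
    exact Finset.mem_filter.2 ⟨Finset.mem_univ _, g.injective⟩
  · refine (c4Ind_eq_one_or G f).resolve_right fun ⟨_, h⟩ => hf' ?_
    exact Finset.mem_image.2 ⟨⟨⟨f, fun {a b} hab => h a b hab⟩, (Finset.mem_filter.1 hf).2⟩,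
      Finset.mem_univ _, rfl⟩

lemma sum_c4Ind_eq (G : SimpleGraph V) :
    ∑ f, c4Ind G f = (Fintype.card V : ℝ) ^ 4 * c4Density G := by
  rcases isEmpty_or_nonempty V with h | h
  · simp
  · rw [c4Density, Fintype.expect_eq_sum_div_card]
    have : (Fintype.card V : ℝ) ≠ 0 := by simp
    simp only [Fintype.card_pi, Finset.prod_const, Finset.card_univ, Fintype.card_fin]
    push_cast
    field_simp

lemma eight_mul_copyCount (G : SimpleGraph V) :
    (G.labelledCopyCount C4 : ℝ) = 8 * G.copyCount C4 := by
  rw [labelledCopyCount_eq_mul, card_aut_C4]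
  push_cast
  rfl

lemma c4Ind_le_one (G : SimpleGraph V) (f : Fin 4 → V) : c4Ind G f ≤ 1 := by
  rcases c4Ind_eq_one_or G f with h | h
  · rw [h]; norm_num
  · exact h.1.le

/-- The factor 3 is `24/8`. There are at most `6n³` non-injective maps, and `n ≥ 12` makes the
falling factorial at least `n⁴/2`, so the error is at most `3 · 6n³ · 2/n⁴`. -/
lemma abs_density_C4_sub_le {n : ℕ} (hn : 12 ≤ n) (G : SimpleGraph (Fin n)) :
    |density C4 G - 3 * c4Density G| ≤ 36 / n := by
  classical
  have hn0 : (0 : ℝ) < n := by exact_mod_cast (by omega : 0 < n)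
  have hn12 : (12 : ℝ) ≤ n := by exact_mod_cast hn
  have : Nonempty (Fin n) := ⟨⟨0, by omega⟩⟩
  have hd1 : c4Density G ≤ 1 := by
    rw [← c4Weight_const_inv_card]
    exact c4Weight_le_one const_mem_stdSimplex
  have hd0 := c4Density_nonneg G
  obtain ⟨hdesc, -⟩ := one_sub_div_le_descFactorial_div n (by omega)
  have hcard : ((Finset.univ.filter fun f : Fin 4 → Fin n => Function.Injective f).card : ℝ) =
      n.descFactorial 4 := by
    rw [← Fintype.card_subtype, Fintype.card_congr (Equiv.subtypeInjectiveEquivEmbedding _ _),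
      Fintype.card_embedding_eq, Fintype.card_fin, Fintype.card_fin]
  have htot := sum_c4Ind_eq G
  rw [Fintype.card_fin, ← Finset.sum_filter_add_sum_filter_not Finset.univ
    (fun f : Fin 4 → Fin n => Function.Injective f), ← labelledCopyCount_C4_eq,
    eight_mul_copyCount] at htot
  have hnn : 0 ≤ ∑ f ∈ Finset.univ.filter (fun f : Fin 4 → Fin n => ¬ Function.Injective f),
    c4Ind G f := Finset.sum_nonneg fun f _ => c4Ind_nonneg G f
  have hni : ∑ f ∈ Finset.univ.filter (fun f : Fin 4 → Fin n => ¬ Function.Injective f),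
      c4Ind G f ≤ n ^ 4 - n.descFactorial 4 := by
    refine (Finset.sum_le_sum fun f _ => c4Ind_le_one G f).trans (le_of_eq ?_)
    have := Finset.card_filter_add_card_filter_not (s := Finset.univ)
      (fun f : Fin 4 → Fin n => Function.Injective f)
    have h2 : (Finset.univ : Finset (Fin 4 → Fin n)).card = n ^ 4 := by simp
    rw [h2] at this
    have h3 : ((Finset.univ.filter fun f : Fin 4 → Fin n => Function.Injective f).card : ℝ) +
      (Finset.univ.filter fun f : Fin 4 → Fin n => ¬ Function.Injective f).card = n ^ 4 := by
      exact_mod_cast this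
    rw [hcard] at h3
    rw [Finset.sum_const, nsmul_eq_mul, mul_one]
    linarith
  have hdpos : (0 : ℝ) < n.descFactorial 4 := by
    exact_mod_cast Nat.descFactorial_pos.2 (by omega)
  have hdle : (n.descFactorial 4 : ℝ) ≤ n ^ 4 := by exact_mod_cast Nat.descFactorial_le_pow n 4
  have hchoose : (n.choose 4 : ℝ) = n.descFactorial 4 / 24 := by
    have := Nat.descFactorial_eq_factorial_mul_choose n 4
    rw [this]
    push_cast [Nat.factorial]
    ring
  have hdens : density C4 G = 3 * (8 * G.copyCount C4) / n.descFactorial 4 := by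
    rw [density, Fintype.card_fin, Fintype.card_fin, hchoose]
    field_simp
    ring
  set N : ℝ := 8 * G.copyCount C4 with hN
  set D : ℝ := (n.descFactorial 4 : ℝ) with hD
  have hN0 : 0 ≤ N := by positivity
  have h6 : (n : ℝ) ^ 4 - 6 * n ^ 3 ≤ D := by
    rw [le_div_iff₀ (by positivity)] at hdesc
    refine le_trans (le_of_eq ?_) hdesc
    field_simp
  have hhalf : (n : ℝ) ^ 4 ≤ 2 * D := by
    have : (12 : ℝ) * n ^ 3 ≤ n * n ^ 3 := mul_le_mul_of_nonneg_right hn12 (by positivity)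
    nlinarith
  have hup : N ≤ n ^ 4 * c4Density G := by linarith
  have hlo : n ^ 4 * c4Density G - 6 * n ^ 3 ≤ N := by linarith
  rw [hdens, abs_le]
  have hmul : 36 / (n : ℝ) * n ^ 4 = 36 * n ^ 3 := by field_simp
  constructor
  · rw [neg_le_sub_iff_le_add, ← sub_le_iff_le_add, le_div_iff₀ hdpos]
    have h36 : 0 ≤ 36 / (n : ℝ) := by positivity
    have h18 : 36 / (n : ℝ) * D ≥ 18 * n ^ 3 := by
      have := mul_le_mul_of_nonneg_left hhalf h36
      nlinarith
    have := mul_le_mul_of_nonneg_left hdle hd0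
    nlinarith
  · rw [sub_le_iff_le_add, div_le_iff₀ hdpos]
    have h36 : 0 ≤ 36 / (n : ℝ) := by positivity
    have h18 : 36 / (n : ℝ) * D ≥ 18 * n ^ 3 := by
      have := mul_le_mul_of_nonneg_left hhalf h36
      nlinarith
    have h7 : c4Density G * (n ^ 4 - D) ≤ 6 * n ^ 3 := by
      refine (mul_le_of_le_one_left (by linarith) hd1).trans (by linarith)
    nlinarith

lemma inducedCopyCount_coCherry_le {n : ℕ} (G : SimpleGraph (Fin n)) :
    (inducedCopyCount coCherry G : ℝ) ≤ n ^ 3 * coCherryDensity G := by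
  classical
  have hsum : (n : ℝ) ^ 3 * coCherryDensity G =
      ∑ f : Fin 3 → Fin n, coCherryInd G (f 0) (f 1) (f 2) := by
    rcases Nat.eq_zero_or_pos n with rfl | hn
    · simp
    · rw [coCherryDensity, Fintype.expect_eq_sum_div_card]
      have : (n : ℝ) ≠ 0 := by positivity
      simp only [Fintype.card_pi, Finset.prod_const, Finset.card_univ, Fintype.card_fin]
      push_cast
      field_simp
  rw [hsum]
  set P : Set (Set (Fin n)) := {S | Nonempty (coCherry ≃g G.induce S)} with hP
  let e : ∀ S : P, coCherry ≃g G.induce S.1 := fun S => S.2.some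
  -- The only edge of `coCherry` is `{0, 2}`, while `coCherryInd` expects the edge in its first two
  -- arguments.
  let f : P → (Fin 3 → Fin n) := fun S => ![e S 0, e S 2, e S 1]
  have hf : Function.Injective f := by
    intro S T hST
    have hr : ∀ S : P, S.1 = Set.range (f S) := by
      intro S
      ext v
      constructor
      · intro hv
        obtain ⟨i, hi⟩ := (e S).surjective ⟨v, hv⟩
        have hv' : v = e S i := by rw [hi]
        subst hv'
        fin_cases i
        · exact ⟨0, rfl⟩
        · exact ⟨2, rfl⟩
        · exact ⟨1, rfl⟩
      · rintro ⟨i, rfl⟩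
        fin_cases i
        · exact (e S 0).2
        · exact (e S 2).2
        · exact (e S 1).2
    exact Subtype.ext (by rw [hr S, hr T, hST])
  have hval : ∀ S : P, coCherryInd G (f S 0) (f S 1) (f S 2) = 1 := by
    intro S
    have hadj : ∀ i j, G.Adj (e S i) (e S j) ↔ coCherry.Adj i j := fun i j =>
      (e S).map_rel_iff
    have h02 : G.Adj (e S 0) (e S 2) := (hadj 0 2).2 (by simp [pathGraph_adj])
    have h01 : ¬ G.Adj (e S 0) (e S 1) := fun h => by
      have := (hadj 0 1).1 h
      simp [pathGraph_adj] at this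
    have h21 : ¬ G.Adj (e S 2) (e S 1) := fun h => by
      have := (hadj 2 1).1 h
      simp [pathGraph_adj] at this
    change coCherryInd G (e S 0) (e S 2) (e S 1) = 1
    simp [coCherryInd, adjInd_of_adj h02, adjInd_of_not_adj h01, adjInd_of_not_adj h21]
  calc (inducedCopyCount coCherry G : ℝ) = ∑ S : P, (1 : ℝ) := by
        rw [inducedCopyCount, ← hP, ← Nat.card_coe_set_eq, Nat.card_eq_fintype_card]
        simp
    _ = ∑ S : P, coCherryInd G (f S 0) (f S 1) (f S 2) :=
        Finset.sum_congr rfl fun S _ => (hval S).symm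
    _ = ∑ g ∈ Finset.univ.map ⟨f, hf⟩, coCherryInd G (g 0) (g 1) (g 2) := by
        rw [Finset.sum_map]; rfl
    _ ≤ _ := Finset.sum_le_sum_of_subset_of_nonneg (Finset.subset_univ _) fun g _ _ =>
        coCherryInd_nonneg _ _ _

end Counting

/-! ### The Turán graph lower bound and the limit. -/

section TuranGraph

lemma c4Density_top_fin {r : ℕ} (hr : 0 < r) :
    c4Density (⊤ : SimpleGraph (Fin r)) = turanC4 r := by
  have : Nonempty (Fin r) := ⟨⟨0, hr⟩⟩
  have hr0 : (r : ℝ) ≠ 0 := by positivity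
  rw [← c4Weight_const_inv_card, CliqueSupported.c4Weight_eq (fun a b _ _ h => h)
    (const_mem_stdSimplex (V := Fin r)).2, turanC4_eq hr0]
  simp only [Finset.sum_const, Finset.card_univ, Fintype.card_fin, nsmul_eq_mul]
  field_simp
  ring

lemma le_c4Density_turanGraph {n r : ℕ} (hr : 3 ≤ r) (hn : r ≤ n) :
    (1 - r / n : ℝ) ^ 4 * turanC4 r ≤ c4Density (turanGraph n r) := by
  classical
  have hr0 : 0 < r := by omega
  have hn0 : (0 : ℝ) < n := by exact_mod_cast (by omega : 0 < n)
  have hrn : (r : ℝ) ≤ n := by exact_mod_cast hn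
  set q := n / r with hq
  have hqr : q * r ≤ n := Nat.div_mul_le_self n r
  have hT : 0 ≤ turanC4 (r : ℝ) := le_trans (by norm_num)
    (two_ninths_le_turanC4 (r := r) (by exact_mod_cast hr))
  -- Parts of `turanGraph` are residue classes mod `r`. Each has at least `q = ⌊n/r⌋` vertices, so
  -- the `q`-fold blow-up of `K_r` embeds.
  let b : Fin r × Fin q → Fin n := fun p => ⟨p.1 + r * p.2, by
    have h1 := p.1.2
    have h2 := p.2.2
    calc (p.1 : ℕ) + r * p.2 < r + r * p.2 := by omega
      _ = (p.2 + 1) * r := by ring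
      _ ≤ q * r := Nat.mul_le_mul_right _ h2
      _ ≤ n := hqr⟩
  have hmod : ∀ p, (b p : ℕ) % r = p.1 := fun p => by
    simp [b, Nat.add_mul_mod_self_left, Nat.mod_eq_of_lt p.1.2]
  have hdiv : ∀ p, (b p : ℕ) / r = p.2 := fun p => by
    simp [b, Nat.add_mul_div_left _ _ hr0, Nat.div_eq_of_lt p.1.2]
  have hb : Function.Injective b := by
    intro p p' h
    have h1 := hmod p
    have h2 := hdiv p
    rw [h, hmod] at h1
    rw [h, hdiv] at h2
    exact Prod.ext (Fin.ext h1.symm) (Fin.ext h2.symm)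
  have hind : ∀ p p', adjInd (turanGraph n r) (b p) (b p') =
      adjInd (⊤ : SimpleGraph (Fin r)) p.1 p'.1 := by
    intro p p'
    by_cases h : p.1 = p'.1
    · rw [adjInd_of_not_adj, adjInd_of_not_adj]
      · simpa using h
      · rw [turanGraph_adj, hmod, hmod, h]; simp
    · rw [adjInd_of_adj, adjInd_of_adj]
      · simpa using h
      · rw [turanGraph_adj, hmod, hmod]; exact fun e => h (Fin.ext e)
  have key : (q : ℝ) ^ 4 * ∑ f, c4Ind (⊤ : SimpleGraph (Fin r)) f ≤
      ∑ f, c4Ind (turanGraph n r) f := by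
    have hinj : Function.Injective fun (p : (Fin 4 → Fin r) × (Fin 4 → Fin q)) (i : Fin 4) =>
        b (p.1 i, p.2 i) := by
      intro p p' h
      have : ∀ i, (p.1 i, p.2 i) = (p'.1 i, p'.2 i) := fun i => hb (congrFun h i)
      exact Prod.ext (funext fun i => congrArg Prod.fst (this i))
        (funext fun i => congrArg Prod.snd (this i))
    calc (q : ℝ) ^ 4 * ∑ f, c4Ind (⊤ : SimpleGraph (Fin r)) f
        = ∑ p : (Fin 4 → Fin r) × (Fin 4 → Fin q), c4Ind (⊤ : SimpleGraph (Fin r)) p.1 := by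
          rw [Fintype.sum_prod_type, Finset.mul_sum]
          simp
      _ = ∑ p : (Fin 4 → Fin r) × (Fin 4 → Fin q),
            c4Ind (turanGraph n r) (fun i => b (p.1 i, p.2 i)) := by
          simp only [c4Ind, hind]
      _ = ∑ g ∈ Finset.univ.map ⟨_, hinj⟩, c4Ind (turanGraph n r) g := by
          rw [Finset.sum_map]; rfl
      _ ≤ _ := Finset.sum_le_sum_of_subset_of_nonneg (Finset.subset_univ _) fun g _ _ =>
          c4Ind_nonneg _ g
  rw [sum_c4Ind_eq, sum_c4Ind_eq, c4Density_top_fin hr0, Fintype.card_fin, Fintype.card_fin] at key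
  have hlow : (n : ℝ) - r ≤ q * r := by
    have h1 : n < (q + 1) * r := by
      rw [hq, mul_comm]; exact Nat.lt_mul_div_succ n hr0
    have h2 : (n : ℝ) < (q + 1) * r := by exact_mod_cast h1
    linarith
  have hpow : ((n : ℝ) - r) ^ 4 ≤ (q * r) ^ 4 := pow_le_pow_left₀ (by linarith) hlow 4
  have e : (1 - r / n : ℝ) ^ 4 * turanC4 r = ((n : ℝ) - r) ^ 4 * turanC4 r / n ^ 4 := by
    rw [one_sub_div hn0.ne', div_pow]
    ring
  rw [e, div_le_iff₀ (by positivity)]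
  calc ((n : ℝ) - r) ^ 4 * turanC4 r ≤ (q * r) ^ 4 * turanC4 r :=
        mul_le_mul_of_nonneg_right hpow hT
    _ = q ^ 4 * (r ^ 4 * turanC4 r) := by ring
    _ ≤ _ := key.trans_eq (mul_comm _ _)

lemma free_turanGraph {W : Type*} {F : SimpleGraph W} {r : ℕ} (hr : 0 < r)
    (hF : ¬ F.Colorable r) (n : ℕ) : F.Free (turanGraph n r) := by
  rintro ⟨f⟩
  refine hF ⟨Coloring.mk (fun w => (⟨f w % r, Nat.mod_lt _ hr⟩ : Fin r)) fun {a b} hab h => ?_⟩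
  exact turanGraph_adj.1 (f.toHom.map_adj hab) (congrArg Fin.val h)

/-- Large `F`-free graphs: an upper bound for the `C₄` density with a co-cherry penalty. -/
theorem exists_density_C4_add_le {W : Type*} [Fintype W] {F : SimpleGraph W} {r : ℕ} (hr : 3 ≤ r)
    (hcol : F.Colorable (r + 1)) {ε : ℝ} (hε : 0 < ε) :
    ∃ n₀ : ℕ, ∀ n : ℕ, n₀ ≤ n → ∀ G : SimpleGraph (Fin n), F.Free G →
      density C4 G + coCherryDensity G / 9 ≤ 3 * turanC4 r + ε := by
  -- Multiplying by 3 turns `ε/6` into `ε/2` and the penalty `1/27` into `1/9`; the remaining `ε/2`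
  -- absorbs `36/n`.
  obtain ⟨κ, hκ, h1⟩ := exists_cliqueDensity_bound hr (show 0 < ε / 6 by positivity)
  obtain ⟨n₁, h2⟩ := exists_cliqueDensity_le_of_free hcol hκ
  obtain ⟨n₂, hn₂⟩ := exists_nat_gt (36 / (ε / 2))
  refine ⟨max n₁ (max n₂ 12), fun n hn G hG => ?_⟩
  have hn1 : n₁ ≤ n := (le_max_left _ _).trans hn
  have hn2 : n₂ ≤ n := (le_max_left _ _).trans ((le_max_right _ _).trans hn)
  have hn12 : 12 ≤ n := (le_max_right _ _).trans ((le_max_right _ _).trans hn)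
  have h3 := h1 n G (by omega) (h2 n G hn1 hG)
  have h4 := (abs_le.1 (abs_density_C4_sub_le hn12 G)).2
  have hn0 : (0 : ℝ) < n := by exact_mod_cast (by omega : 0 < n)
  have h5 : 36 / (n : ℝ) ≤ ε / 2 := by
    have : (n₂ : ℝ) ≤ n := by exact_mod_cast hn2
    rw [div_lt_iff₀ (by positivity)] at hn₂
    rw [div_le_iff₀ hn0]
    nlinarith
  linarith

theorem tendsto_maxDensityC4 {W : Type*} [Fintype W] {F : SimpleGraph W} {r : ℕ} (hr : 3 ≤ r)
    (hcol : F.Colorable (r + 1)) (hncol : ¬ F.Colorable r) :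
    Tendsto (maxDensityC4 F) atTop (nhds (3 * turanC4 r)) := by
  have hlow : Tendsto (fun n : ℕ => 3 * ((1 - r / n : ℝ) ^ 4 * turanC4 r) - 36 / n) atTop
      (nhds (3 * ((1 - 0) ^ 4 * turanC4 r) - 0)) :=
    ((((tendsto_const_nhds.sub (tendsto_const_div_atTop_nhds_zero_nat _)).pow 4).mul_const
      _).const_mul 3).sub (tendsto_const_div_atTop_nhds_zero_nat _)
  have e : 3 * ((1 - 0) ^ 4 * turanC4 r) - 0 = 3 * turanC4 (r : ℝ) := by ring
  rw [e] at hlow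
  refine tendsto_order.2 ⟨fun a ha => ?_, fun a ha => ?_⟩
  · filter_upwards [(tendsto_order.1 hlow).1 a ha, eventually_ge_atTop (max r 12)] with n h1 h2
    refine h1.trans_le ?_
    have h3 := (abs_le.1 (abs_density_C4_sub_le ((le_max_right _ _).trans h2)
      (turanGraph n r))).1
    have h4 := le_c4Density_turanGraph hr ((le_max_left _ _).trans h2)
    have h5 : density C4 (turanGraph n r) ≤ maxDensityC4 F n :=
      le_ciSup (f := fun G : {G : SimpleGraph (Fin n) // F.Free G} => density C4 G.1)
        (Set.finite_range _).bddAbove ⟨turanGraph n r, free_turanGraph (by omega) hncol n⟩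
    linarith
  · obtain ⟨n₀, hn₀⟩ := exists_density_C4_add_le hr hcol
      (show 0 < (a - 3 * turanC4 r) / 2 by linarith)
    filter_upwards [eventually_ge_atTop n₀] with n hn
    have : Nonempty {G : SimpleGraph (Fin n) // F.Free G} :=
      ⟨⟨turanGraph n r, free_turanGraph (by omega) hncol n⟩⟩
    refine lt_of_le_of_lt (ciSup_le (c := 3 * turanC4 r + (a - 3 * turanC4 r) / 2)
      fun G => ?_) (by linarith)
    have := hn₀ n hn G.1 G.2
    have := coCherryDensity_nonneg G.1
    linarith

end TuranGraph

end TuranGood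

theorem lemma2p6 {W : Type*} [Fintype W] (F : SimpleGraph W) (r : ℕ) (hr : 3 ≤ r)
    (hχ : F.chromaticNumber = ((r + 1 : ℕ) : ℕ∞))
    (hcrit : TuranGood.HasColorCriticalEdge F) :
    -- the limit that defines `OPT` exists
    Filter.Tendsto (TuranGood.maxDensityC4 F) Filter.atTop (nhds (TuranGood.OPT F)) ∧
    TuranGood.OPT F = 3 * ((r : ℝ) - 1) * ((r : ℝ) ^ 2 - 3 * (r : ℝ) + 3) / (r : ℝ) ^ 3 ∧
    ∀ δ : ℝ, 0 < δ → ∃ ε : ℝ, 0 < ε ∧ ∃ n₀ : ℕ, ∀ n : ℕ, n₀ ≤ n →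
      ∀ G : SimpleGraph (Fin n), F.Free G →
        TuranGood.OPT F - ε ≤ TuranGood.density TuranGood.C4 G →
        (TuranGood.inducedCopyCount TuranGood.coCherry G : ℝ) ≤ δ * (n : ℝ) ^ 3 := by
  have hcol : F.Colorable (r + 1) := SimpleGraph.chromaticNumber_le_iff_colorable.1 hχ.le
  have hncol : ¬ F.Colorable r := fun h => by
    have h' := SimpleGraph.chromaticNumber_le_iff_colorable.2 h
    rw [hχ] at h'
    have : r + 1 ≤ r := by exact_mod_cast h'
    omega
  have hlim := TuranGood.tendsto_maxDensityC4 hr hcol hncol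
  have hopt : TuranGood.OPT F = 3 * TuranGood.turanC4 r := hlim.limUnder_eq
  refine ⟨hopt ▸ hlim, ?_, fun δ hδ => ?_⟩
  · rw [hopt, TuranGood.turanC4]
    ring
  · obtain ⟨n₀, hn₀⟩ := TuranGood.exists_density_C4_add_le hr hcol (show 0 < δ / 18 by positivity)
    -- The two errors of `δ/18` add up to `δ/9`, exactly the weight `1/9` of the penalty times `δ`.
    refine ⟨δ / 18, by positivity, n₀, fun n hn G hG hd => ?_⟩
    have h1 := hn₀ n hn G hG
    rw [hopt] at hd
    have h2 : TuranGood.coCherryDensity G ≤ δ := by linarith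
    refine (TuranGood.inducedCopyCount_coCherry_le G).trans ?_
    rw [mul_comm]
    exact mul_le_mul_of_nonneg_right h2 (by positivity)
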